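/- **Setting.** Consider a family, indexed by a set $S$, of dimensions $n=n_s$, $p=p_s$ and of random matrices $X=(x_1,\dots,x_n)\in\mathcal M_{p,n}(\mathbb R)$; below, $O(1)$ and "constants" are uniform in $s\in S$ and in the column index $i\in[n]$. Assume: 1. $X\propto\mathcal E_2$: there are constants $C,c>0$ such that for every $g:\mathcal M_{p,n}\to\mathbb R$ that is $1$-Lipschitz for the Frobenius norm, $g(X)$ is integrable and $\mathbb P(|g(X)-\mathbb E[g(X)]|\ge t)\le Ce^{-(t/c)^2}$ for all $t>0$; 2. the columns $x_1,\dots,x_n\in\mathbb R^p$ are independent; 3. $ap\le n\le bp$ for two constants $a,b>0$; 4. $\sup_i\|\mathbb E[x_i]\|\le O(1)$ and $\inf_i\frac1n\operatorname{tr}\mathbb E[x_ix_i^T]\ge\kappa$ for a constant $\kappa>0$; 5. $f:\mathbb R\to\mathbb R$ is a fixed twice differentiable function (it does not depend on $s$) with $\|f''\|_\infty<\infty$, and there are constants $\lambda,\varepsilon>0$ with $\|f'\|_\infty\le\lambda$ and $1-\frac\lambda n\mathbb E[\|XX^T\|]\ge2\varepsilon$, where $\|\cdot\|$ is the spectral norm.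 Set $\mathcal A_Y=\{\frac\lambda n\|XX^T\|\le1-\varepsilon\}$. Let $Y$, $Y_{-i}$ and $y_{-i}(t)$, $t\in[0,1]$, be the solutions of $$Y=\frac1n\sum_{j=1}^nf(x_j^TY)x_j,\qquad Y_{-i}=\frac1n\sum_{j\ne i}f(x_j^TY_{-i})x_j,\qquad y_{-i}(t)=\frac1n\sum_{j\ne i}f(x_j^Ty_{-i}(t))x_j+\frac tnf(x_i^Ty_{-i}(t))x_i,$$ and let $Q_{-i}=\big(I_p-\frac1n\sum_{j\neq i}f'(x_j^TY_{-i})x_jx_j^T\big)^{-1}$. **Proposition.** On $\mathcal A_Y$ the three equations have unique solutions and the inverse defining $Q_{-i}$ exists; $\mathbb P(\mathcal A_Y)>0$ and $\mathbb P(\mathcal A_Y^c)\le Ce^{-cn}$ for constants $C,c>0$. For all $i\in[n]$, $$M_i=\mathbb E\Big[\sup_{t\in[0,1]}|x_i^Ty_{-i}(t)|\ \Big|\ \mathcal A_Y\Big]\le O(1).$$ If moreover $\|f\|_\infty<\infty$, then, for all $i\in[n]$, $\big\|Y-Y_{-i}-\frac1nf(x_i^TY)Q_{-i}x_i\big\|\in0\pm\mathcal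 E_2(1/n)\ |\ e^{-n}$ with concentration zone $\mathcal A_Y$, that is, there are constants $C,c>0$ with $$\mathbb P(\mathcal A_Y^c)\le Ce^{-n/c},\qquad \mathbb P\Big(\big\|Y-Y_{-i}-\tfrac1nf(x_i^TY)Q_{-i}x_i\big\|\ge t\ \Big|\ \mathcal A_Y\Big)\le Ce^{-(nt/c)^2}\quad\text{for all }t>0.$$ -/

import Mathlib

open MeasureTheory ProbabilityTheory

noncomputable section

namespace RobustRegression

/-! ### Concentration of families of random vectors -/

section Concentration

universe u v w

variable {S : Type u} {Ω : S → Type v} [∀ s, MeasurableSpace (Ω s)]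

/-- `Z ∝ 𝓔_q(σ)`: every 1-Lipschitz observation `g (Z s)` of the random vector `Z s` has an
expectation and is concentrated around it, with constants `C, c` that are valid for every index
`s` of the family. -/
def LipschitzConcentrated {E : S → Type w} [∀ s, NormedAddCommGroup (E s)]
    (P : ∀ s, Measure (Ω s)) (Z : ∀ s, Ω s → E s) (q : ℝ) (σ : S → ℝ) : Prop :=
  ∃ C > 0, ∃ c > 0, ∀ s, ∀ g : E s → ℝ, LipschitzWith 1 g →
    Integrable (fun ω => g (Z s ω)) (P s) ∧
    ∀ t : ℝ, 0 < t →
      (P s).real {ω | t ≤ |g (Z s ω) - ∫ ω', g (Z s ω') ∂(P s)|}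
        ≤ C * Real.exp (-(t / (c * σ s)) ^ q)

/-- `Z ∈ Z₀ ± 𝓔_q(σ) | e^{-θ}` with concentration zone `A`: the events `A s` satisfy
`ℙ(Aᶜ) ≤ C e^{-θ/c}`, and conditionally on `A s` every linear form of norm at most one of the
random vector `Z s` is concentrated around its value at the deterministic vector `Z₀ s`.
`(P s)[|A s]` is the conditional probability `P s (· ∩ A s) / P s (A s)`. -/
def LinearlyConcentratedOn {E : S → Type w} [∀ s, NormedAddCommGroup (E s)]
    [∀ s, NormedSpace ℝ (E s)]
    (P : ∀ s, Measure (Ω s)) (A : ∀ s, Set (Ω s)) (Z : ∀ s, Ω s → E s) (Z₀ : ∀ s, E s)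
    (q : ℝ) (σ θ : S → ℝ) : Prop :=
  (∀ s, MeasurableSet (A s) ∧ P s (A s) ≠ 0 ∧ AEStronglyMeasurable (Z s) ((P s)[|A s])) ∧
  ∃ C > 0, ∃ c > 0, ∀ s,
    (P s).real (A s)ᶜ ≤ C * Real.exp (-(θ s / c)) ∧
    ∀ φ : E s →L[ℝ] ℝ, ‖φ‖ ≤ 1 → ∀ t : ℝ, 0 < t →
      ((P s)[|A s]).real {ω | t ≤ |φ (Z s ω) - φ (Z₀ s)|}
        ≤ C * Real.exp (-(t / (c * σ s)) ^ q)

end Concentration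

/-! ### The fixed points. The data are the columns `x j ∈ ℝᵖ`, `j ∈ [n]`, of a matrix `X`. -/

section FixedPoint

variable {n p : ℕ}

/-- The matrix `X = (x₁, …, xₙ)` with columns `x j`. -/
def dataMatrix (x : Fin n → EuclideanSpace ℝ (Fin p)) : Matrix (Fin p) (Fin n) ℝ :=
  Matrix.of fun a j => x j a

/-- The spectral norm `‖X Xᵀ‖`. -/
def gramNorm (x : Fin n → EuclideanSpace ℝ (Fin p)) : ℝ :=
  ‖Matrix.toEuclideanCLM (𝕜 := ℝ) (n := Fin p) (dataMatrix x * (dataMatrix x).transpose)‖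

/-- The unique solution of `y = Φ y` (and `0` if there is no unique solution). -/
def uniqueFixedPoint {E : Type*} [Zero E] (Φ : E → E) : E :=
  open Classical in if h : ∃! y, y = Φ y then h.choose else 0

/-- `y ↦ (1/n) ∑ⱼ f(xⱼᵀ y) xⱼ`. -/
def regressionMap (f : ℝ → ℝ) (x : Fin n → EuclideanSpace ℝ (Fin p))
    (y : EuclideanSpace ℝ (Fin p)) : EuclideanSpace ℝ (Fin p) :=
  (1 / (n : ℝ)) • ∑ j, f (inner ℝ (x j) y) • x j

/-- `y ↦ (1/n) ∑_{j ≠ i} f(xⱼᵀ y) xⱼ`. -/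
def leaveOneOutMap (f : ℝ → ℝ) (x : Fin n → EuclideanSpace ℝ (Fin p)) (i : Fin n)
    (y : EuclideanSpace ℝ (Fin p)) : EuclideanSpace ℝ (Fin p) :=
  (1 / (n : ℝ)) • ∑ j ∈ Finset.univ.erase i, f (inner ℝ (x j) y) • x j

/-- `y ↦ (1/n) ∑_{j ≠ i} f(xⱼᵀ y) xⱼ + (t/n) f(xᵢᵀ y) xᵢ`. -/
def bridgeMap (f : ℝ → ℝ) (x : Fin n → EuclideanSpace ℝ (Fin p)) (i : Fin n) (t : ℝ)
    (y : EuclideanSpace ℝ (Fin p)) : EuclideanSpace ℝ (Fin p) :=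
  leaveOneOutMap f x i y + (t / (n : ℝ)) • f (inner ℝ (x i) y) • x i

/-- `Y`. -/
def regressor (f : ℝ → ℝ) (x : Fin n → EuclideanSpace ℝ (Fin p)) : EuclideanSpace ℝ (Fin p) :=
  uniqueFixedPoint (regressionMap f x)

/-- `Y₋ᵢ`. -/
def leaveOneOut (f : ℝ → ℝ) (x : Fin n → EuclideanSpace ℝ (Fin p)) (i : Fin n) :
    EuclideanSpace ℝ (Fin p) :=
  uniqueFixedPoint (leaveOneOutMap f x i)

/-- `y₋ᵢ(t)`. -/
def bridge (f : ℝ → ℝ) (x : Fin n → EuclideanSpace ℝ (Fin p)) (i : Fin n) (t : ℝ) :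
    EuclideanSpace ℝ (Fin p) :=
  uniqueFixedPoint (bridgeMap f x i t)

/-- `I_p - (1/n) X D₋ᵢ Xᵀ`, where `D₋ᵢ` is diagonal with entries `f'(xⱼᵀ Y₋ᵢ)` for `j ≠ i` and
`0` for `j = i`. -/
def preResolvent (f : ℝ → ℝ) (x : Fin n → EuclideanSpace ℝ (Fin p)) (i : Fin n) :
    Matrix (Fin p) (Fin p) ℝ :=
  1 - (1 / (n : ℝ)) • (dataMatrix x *
    Matrix.diagonal (fun j => if j = i then 0 else deriv f (inner ℝ (x j) (leaveOneOut f x i))) *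
    (dataMatrix x).transpose)

/-- `Q₋ᵢ = (I_p - (1/n) X D₋ᵢ Xᵀ)⁻¹`. -/
def resolvent (f : ℝ → ℝ) (x : Fin n → EuclideanSpace ℝ (Fin p)) (i : Fin n) :
    Matrix (Fin p) (Fin p) ℝ :=
  (preResolvent f x i)⁻¹

/-- `‖Y - Y₋ᵢ - (1/n) f(xᵢᵀ Y) Q₋ᵢ xᵢ‖`. -/
def residualNorm (f : ℝ → ℝ) (x : Fin n → EuclideanSpace ℝ (Fin p)) (i : Fin n) : ℝ :=
  ‖regressor f x - leaveOneOut f x i -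
    (1 / (n : ℝ)) • f (inner ℝ (x i) (regressor f x)) •
      Matrix.toEuclideanCLM (𝕜 := ℝ) (n := Fin p) (resolvent f x i) (x i)‖

/-- `sup_{t ∈ [0,1]} |xᵢᵀ y₋ᵢ(t)|`, as an extended nonnegative real. -/
def supBridge (f : ℝ → ℝ) (x : Fin n → EuclideanSpace ℝ (Fin p)) (i : Fin n) : ENNReal :=
  ⨆ t : Set.Icc (0 : ℝ) 1, ENNReal.ofReal |inner ℝ (x i) (bridge f x i t)|

end FixedPoint

/-- `Σ = 𝔼[Z Zᵀ]`. -/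
def secondMoment {Ω : Type*} [MeasurableSpace Ω] {p : ℕ} (P : Measure Ω)
    (Z : Ω → EuclideanSpace ℝ (Fin p)) : Matrix (Fin p) (Fin p) ℝ :=
  Matrix.of fun a b => ∫ ω, Z ω a * Z ω b ∂P

/-- The event `𝓐_Y = {(lam/n) ‖X Xᵀ‖ ≤ 1 - ε}`. -/
def goodEvent {Ω : Type*} {n p : ℕ} (x : Fin n → Ω → EuclideanSpace ℝ (Fin p)) (lam ε : ℝ) :
    Set Ω :=
  {ω | lam / n * gramNorm (fun j => x j ω) ≤ 1 - ε}

end RobustRegression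

end

/-!
On the good data `(lam / n) ‖X Xᵀ‖ ≤ 1 - ε` every map at hand is a `(1 - ε)`-contraction, which
gives existence, uniqueness and continuity in the data. The concentration of `√‖X Xᵀ‖`, a
`1`-Lipschitz function of `X`, makes the complement exponentially unlikely.

For the bridge, `|xᵢᵀ y₋ᵢ(t)|` is at most a multiple of `1 + |xᵢᵀ Y₋ᵢ|`, and `Y₋ᵢ` is bounded and
independent of `xᵢ`: freezing the other columns reduces `Mᵢ` to the first moment of a linear form
of `xᵢ`.

For the residual, a Taylor expansion of `f` at `xⱼᵀ Y₋ᵢ` shows that `Q₋ᵢ⁻¹` maps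
`R(t) = y₋ᵢ(t) - Y₋ᵢ - (t/n) f(xᵢᵀ y₋ᵢ(t)) Q₋ᵢ xᵢ` to an average of vectors
`O((xⱼᵀ (y₋ᵢ(t) - Y₋ᵢ))²) xⱼ`, so that `‖R(t)‖` satisfies a quadratic inequality governed by the
`ℓ⁴` norm of `(xⱼᵀ Q₋ᵢ xᵢ)ⱼ`. As `R(0) = 0`, continuity in `t` selects the small root. For frozen
`xⱼ`, `j ≠ i`, this `ℓ⁴` norm is a Lipschitz function of `xᵢ`, with Lipschitz constant `O(√n)` and
mean `O(n^{3/4})`, and inherits the concentration of `xᵢ`.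
-/

open scoped NNReal ENNReal

noncomputable section

namespace RobustRegression

section FixedPoints

variable {E : Type*} [NormedAddCommGroup E]

lemma uniqueFixedPoint_spec {Φ : E → E} (h : ∃! y, y = Φ y) :
    uniqueFixedPoint Φ = Φ (uniqueFixedPoint Φ) := by
  rw [uniqueFixedPoint, dif_pos h]
  exact h.choose_spec.1

variable [CompleteSpace E] {Φ : E → E} {K : ℝ≥0}

lemma existsUnique_fixedPoint (h : ContractingWith K Φ) : ∃! y, y = Φ y :=
  ⟨h.fixedPoint, h.fixedPoint_isFixedPt.symm, fun _ hy => h.fixedPoint_unique hy.symm⟩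

lemma norm_uniqueFixedPoint_sub_le (h : ContractingWith K Φ) (z : E) :
    ‖uniqueFixedPoint Φ - z‖ ≤ ‖Φ z - z‖ / (1 - K) := by
  have hfix := uniqueFixedPoint_spec (existsUnique_fixedPoint h)
  rw [h.fixedPoint_unique hfix.symm, ← dist_eq_norm, ← dist_eq_norm, dist_comm, dist_comm (Φ z)]
  exact h.dist_fixedPoint_le z

lemma continuousOn_uniqueFixedPoint {A : Type*} [TopologicalSpace A] {s : Set A}
    {Φ : A → E → E} (hΦ : ∀ a ∈ s, ContractingWith K (Φ a))
    (hcont : ∀ y, ContinuousOn (fun a => Φ a y) s) :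
    ContinuousOn (fun a => uniqueFixedPoint (Φ a)) s := by
  intro a ha
  set y := uniqueFixedPoint (Φ a)
  have hfix : Φ a y = y := (uniqueFixedPoint_spec (existsUnique_fixedPoint (hΦ a ha))).symm
  rw [ContinuousWithinAt, tendsto_iff_norm_sub_tendsto_zero]
  refine squeeze_zero' (.of_forall fun _ => norm_nonneg _)
    (eventually_nhdsWithin_of_forall fun b hb => norm_uniqueFixedPoint_sub_le (hΦ b hb) y) ?_
  simpa [hfix] using ((hcont y a ha).sub_const y).norm.div_const (1 - (K : ℝ))

end FixedPoints

section AnalysisOperator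

variable {ι E : Type*} [NormedAddCommGroup E] [InnerProductSpace ℝ E]

/-- The analysis operator `y ↦ (xⱼᵀ y)ⱼ` of a finite family of vectors: it is `Xᵀ` when the `xⱼ`
are the columns of `X`, and its adjoint is the synthesis operator `a ↦ ∑ⱼ aⱼ xⱼ`. -/
def analysis (x : ι → E) : E →L[ℝ] EuclideanSpace ℝ ι :=
  (PiLp.continuousLinearEquiv 2 ℝ fun _ : ι => ℝ).symm.toContinuousLinearMap ∘L
    ContinuousLinearMap.pi fun j => innerSL ℝ (x j)

@[simp]
lemma analysis_apply (x : ι → E) (y : E) (j : ι) : analysis x y j = inner ℝ (x j) y := rfl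

lemma analysis_sub_apply (x z : ι → E) (y : E) :
    analysis (x - z) y = analysis x y - analysis z y := by
  ext j
  simp [inner_sub_left]

variable [Fintype ι]

lemma norm_analysis_apply_sq (x : ι → E) (y : E) :
    ‖analysis x y‖ ^ 2 = ∑ j, inner ℝ (x j) y ^ 2 := by
  simp [EuclideanSpace.norm_sq_eq]

lemma norm_analysis_le (X : PiLp 2 fun _ : ι => E) : ‖analysis X.ofLp‖ ≤ ‖X‖ := by
  refine ContinuousLinearMap.opNorm_le_bound _ (norm_nonneg _) fun y => ?_
  refine le_of_sq_le_sq ?_ (by positivity)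
  rw [norm_analysis_apply_sq, mul_pow, PiLp.norm_sq_eq_of_L2, Finset.sum_mul]
  refine Finset.sum_le_sum fun j _ => ?_
  rw [← mul_pow, sq_le_sq, abs_of_nonneg (a := _ * _) (by positivity)]
  exact abs_real_inner_le_norm _ _

lemma lipschitzWith_norm_analysis :
    LipschitzWith 1 fun X : PiLp 2 (fun _ : ι => E) => ‖analysis X.ofLp‖ := by
  refine LipschitzWith.of_dist_le_mul fun X Z => ?_
  rw [NNReal.coe_one, one_mul, dist_eq_norm X]
  calc dist ‖analysis X.ofLp‖ ‖analysis Z.ofLp‖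
      ≤ ‖analysis X.ofLp - analysis Z.ofLp‖ := abs_norm_sub_norm_le _ _
    _ = ‖analysis (X - Z).ofLp‖ := by
        congr 1
        ext1 y
        simp only [WithLp.ofLp_sub, analysis_sub_apply, sub_apply]
    _ ≤ ‖X - Z‖ := norm_analysis_le _

lemma norm_analysis_update_zero_le [DecidableEq ι] (x : ι → E) (i : ι) :
    ‖analysis (Function.update x i 0)‖ ≤ ‖analysis x‖ := by
  refine ContinuousLinearMap.opNorm_le_bound _ (norm_nonneg _) fun y => ?_
  refine le_trans (le_of_sq_le_sq ?_ (norm_nonneg _)) ((analysis x).le_opNorm y)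
  rw [norm_analysis_apply_sq, norm_analysis_apply_sq]
  refine Finset.sum_le_sum fun j _ => ?_
  rcases eq_or_ne j i with rfl | hj
  · simpa using sq_nonneg _
  · simp [hj]

variable [CompleteSpace E]

lemma adjoint_analysis_apply (x : ι → E) (a : EuclideanSpace ℝ ι) :
    ContinuousLinearMap.adjoint (analysis x) a = ∑ j, a j • x j := by
  refine ext_inner_right ℝ fun y => ?_
  simp [ContinuousLinearMap.adjoint_inner_left, sum_inner, real_inner_smul_left,
    PiLp.inner_apply, mul_comm]

lemma norm_sum_smul_le (x : ι → E) (a : EuclideanSpace ℝ ι) :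
    ‖∑ j, a j • x j‖ ≤ ‖analysis x‖ * ‖a‖ := by
  rw [← adjoint_analysis_apply, ← LinearIsometryEquiv.norm_map ContinuousLinearMap.adjoint]
  exact ContinuousLinearMap.le_opNorm _ _

lemma norm_le_norm_analysis (x : ι → E) (i : ι) : ‖x i‖ ≤ ‖analysis x‖ := by
  classical
  simpa [PiLp.single_apply, ite_smul] using norm_sum_smul_le x (EuclideanSpace.single i 1)

lemma norm_sum_smul_le_of_abs_le (x : ι → E) {a : ι → ℝ} {l : ℝ} {v : E} (hl : 0 ≤ l)
    (ha : ∀ j, |a j| ≤ l * |inner ℝ (x j) v|) :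
    ‖∑ j, a j • x j‖ ≤ l * ‖analysis x‖ ^ 2 * ‖v‖ := by
  have hcoef : ‖WithLp.toLp 2 a‖ ≤ l * ‖analysis x v‖ := by
    refine le_of_sq_le_sq ?_ (by positivity)
    rw [mul_pow, norm_analysis_apply_sq, EuclideanSpace.norm_sq_eq, Finset.mul_sum]
    refine Finset.sum_le_sum fun j _ => ?_
    rw [← sq_abs (inner ℝ (x j) v), ← mul_pow]
    exact pow_le_pow_left₀ (norm_nonneg _) (ha j) 2
  calc ‖∑ j, a j • x j‖ ≤ ‖analysis x‖ * ‖WithLp.toLp 2 a‖ := norm_sum_smul_le x (WithLp.toLp 2 a)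
    _ ≤ ‖analysis x‖ * (l * (‖analysis x‖ * ‖v‖)) := by
      gcongr
      exact hcoef.trans (by gcongr; exact (analysis x).le_opNorm v)
    _ = l * ‖analysis x‖ ^ 2 * ‖v‖ := by ring

end AnalysisOperator

section GramNorm

variable {n p : ℕ} (x : Fin n → EuclideanSpace ℝ (Fin p))

lemma toEuclideanCLM_dataMatrix_mul_diagonal_mul_transpose (d : Fin n → ℝ)
    (y : EuclideanSpace ℝ (Fin p)) :
    Matrix.toEuclideanCLM (𝕜 := ℝ) (n := Fin p)
      (dataMatrix x * Matrix.diagonal d * (dataMatrix x).transpose) y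
      = ∑ j, (d j * inner ℝ (x j) y) • x j := by
  ext a
  rw [Matrix.ofLp_toEuclideanCLM, ← Matrix.mulVec_mulVec, ← Matrix.mulVec_mulVec]
  simp [Matrix.mulVec, dotProduct, dataMatrix, Matrix.diagonal_apply, PiLp.inner_apply, mul_comm]

lemma gramNorm_eq_norm_analysis_sq : gramNorm x = ‖analysis x‖ ^ 2 := by
  rw [gramNorm, sq, ← ContinuousLinearMap.norm_adjoint_comp_self]
  congr 1
  ext1 y
  have h := toEuclideanCLM_dataMatrix_mul_diagonal_mul_transpose x (fun _ => 1) y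
  rw [Matrix.diagonal_one, Matrix.mul_one] at h
  rw [h, ContinuousLinearMap.comp_apply, adjoint_analysis_apply]
  simp

lemma gramNorm_nonneg : 0 ≤ gramNorm x := norm_nonneg _

lemma lipschitzWith_sqrt_gramNorm :
    LipschitzWith 1 fun X : PiLp 2 (fun _ : Fin n => EuclideanSpace ℝ (Fin p)) =>
      √(gramNorm X.ofLp) := by
  simpa only [gramNorm_eq_norm_analysis_sq, Real.sqrt_sq (norm_nonneg _)]
    using lipschitzWith_norm_analysis

variable (n p) in
lemma continuous_gramNorm :
    Continuous fun x : Fin n → EuclideanSpace ℝ (Fin p) => gramNorm x := by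
  simp only [gramNorm_eq_norm_analysis_sq]
  exact (lipschitzWith_norm_analysis.continuous.comp (PiLp.continuous_toLp 2 _)).pow 2

end GramNorm

section BridgeMap

variable {n p : ℕ} (f : ℝ → ℝ) (x : Fin n → EuclideanSpace ℝ (Fin p)) (i : Fin n)

lemma bridgeMap_apply (t : ℝ) (y : EuclideanSpace ℝ (Fin p)) :
    bridgeMap f x i t y = (1 / (n : ℝ)) • ∑ j,
      (Function.update (1 : Fin n → ℝ) i t j * f (inner ℝ (x j) y)) • x j := by
  rw [bridgeMap, leaveOneOutMap, ← Finset.sum_erase_add _ _ (Finset.mem_univ i), smul_add]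
  congr 1
  · congr 1
    refine Finset.sum_congr rfl fun j hj => ?_
    rw [Function.update_of_ne (Finset.ne_of_mem_erase hj), Pi.one_apply, one_mul]
  · rw [Function.update_self, smul_smul, smul_smul]
    congr 1
    ring

lemma leaveOneOutMap_eq_bridgeMap_zero : leaveOneOutMap f x i = bridgeMap f x i 0 := by
  ext1 y
  rw [bridgeMap, zero_div, zero_smul, add_zero]

lemma regressionMap_eq_bridgeMap_one : regressionMap f x = bridgeMap f x i 1 := by
  ext1 y
  have hone : Function.update (1 : Fin n → ℝ) i 1 = 1 := Function.update_eq_self i 1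
  simp only [regressionMap, bridgeMap_apply, hone, Pi.one_apply, one_mul]

lemma leaveOneOut_eq_bridge_zero : leaveOneOut f x i = bridge f x i 0 := by
  rw [leaveOneOut, bridge, leaveOneOutMap_eq_bridgeMap_zero]

lemma regressor_eq_bridge_one : regressor f x = bridge f x i 1 := by
  rw [regressor, bridge, regressionMap_eq_bridgeMap_one f x i]

lemma leaveOneOut_update (v : EuclideanSpace ℝ (Fin p)) :
    leaveOneOut f (Function.update x i v) i = leaveOneOut f x i := by
  have hmap : leaveOneOutMap f (Function.update x i v) i = leaveOneOutMap f x i := by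
    ext1 y
    rw [leaveOneOutMap, leaveOneOutMap]
    congr 1
    refine Finset.sum_congr rfl fun j hj => ?_
    rw [Function.update_of_ne (Finset.ne_of_mem_erase hj)]
  rw [leaveOneOut, leaveOneOut, hmap]

lemma abs_update_one_le_one {t : ℝ} (ht : t ∈ Set.Icc (0 : ℝ) 1) (j : Fin n) :
    |Function.update (1 : Fin n → ℝ) i t j| ≤ 1 := by
  rcases eq_or_ne j i with rfl | hj
  · rw [Function.update_self, abs_of_nonneg ht.1]
    exact ht.2
  · rw [Function.update_of_ne hj, Pi.one_apply, abs_one]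

end BridgeMap

section GoodData

variable {n p : ℕ} {f : ℝ → ℝ} {lam : ℝ≥0} {ε : ℝ} {x : Fin n → EuclideanSpace ℝ (Fin p)}

/-- The data for which the regression equations are contractions, so that
`goodEvent x lam ε = {ω | X(ω) ∈ goodData n p lam ε}`. -/
def goodData (n p : ℕ) (lam ε : ℝ) : Set (Fin n → EuclideanSpace ℝ (Fin p)) :=
  {x | lam / n * gramNorm x ≤ 1 - ε}

lemma mem_goodData_iff {lam : ℝ} :
    x ∈ goodData n p lam ε ↔ lam / n * ‖analysis x‖ ^ 2 ≤ 1 - ε := by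
  rw [← gramNorm_eq_norm_analysis_sq]
  rfl

lemma isClosed_goodData (lam ε : ℝ) : IsClosed (goodData n p lam ε) :=
  isClosed_le (continuous_const.mul (continuous_gramNorm n p)) continuous_const

lemma update_zero_mem_goodData (hx : x ∈ goodData n p lam ε) (i : Fin n) :
    Function.update x i 0 ∈ goodData n p lam ε := by
  rw [mem_goodData_iff] at hx ⊢
  refine le_trans ?_ hx
  gcongr
  exact norm_analysis_update_zero_le x i

lemma norm_analysis_le_of_mem_goodData (hlam : 0 < lam) (hε : 0 < ε)
    (hx : x ∈ goodData n p lam ε) : ‖analysis x‖ ≤ √(n / lam) := by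
  refine Real.le_sqrt_of_sq_le ?_
  rw [mem_goodData_iff] at hx
  rcases n.eq_zero_or_pos with rfl | hn
  · have hzero : analysis x = 0 := by ext y j; exact j.elim0
    simp [hzero]
  · rw [div_mul_eq_mul_div, div_le_iff₀ (by positivity)] at hx
    rw [le_div_iff₀ (by positivity)]
    have : (0 : ℝ) < n := by positivity
    nlinarith

lemma norm_column_le_of_mem_goodData (hlam : 0 < lam) (hε : 0 < ε)
    (hx : x ∈ goodData n p lam ε) (i : Fin n) : ‖x i‖ ≤ √(n / lam) :=
  (norm_le_norm_analysis x i).trans (norm_analysis_le_of_mem_goodData hlam hε hx)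

lemma norm_average_le_of_mem_goodData (hx : x ∈ goodData n p lam ε) {a : Fin n → ℝ}
    {v : EuclideanSpace ℝ (Fin p)} (ha : ∀ j, |a j| ≤ lam * |inner ℝ (x j) v|) :
    ‖(1 / (n : ℝ)) • ∑ j, a j • x j‖ ≤ (1 - ε) * ‖v‖ := by
  rw [mem_goodData_iff] at hx
  rw [norm_smul, Real.norm_of_nonneg (by positivity)]
  calc 1 / (n : ℝ) * ‖∑ j, a j • x j‖ ≤ 1 / (n : ℝ) * (lam * ‖analysis x‖ ^ 2 * ‖v‖) := by
        gcongr
        exact norm_sum_smul_le_of_abs_le x lam.coe_nonneg ha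
    _ = lam / n * ‖analysis x‖ ^ 2 * ‖v‖ := by ring
    _ ≤ (1 - ε) * ‖v‖ := by gcongr

lemma nonneg_of_mem_goodData (hx : x ∈ goodData n p lam ε) : 0 ≤ 1 - ε :=
  le_trans (by positivity) (mem_goodData_iff.1 hx)

end GoodData

section Bridge

variable {n p : ℕ} {f : ℝ → ℝ} {lam : ℝ≥0} {ε : ℝ} {x : Fin n → EuclideanSpace ℝ (Fin p)}

lemma contractingWith_bridgeMap (hlip : LipschitzWith lam f) (hε : 0 < ε)
    (hx : x ∈ goodData n p lam ε) (i : Fin n) {t : ℝ} (ht : t ∈ Set.Icc (0 : ℝ) 1) :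
    ContractingWith (1 - ε).toNNReal (bridgeMap f x i t) := by
  refine ⟨by rw [Real.toNNReal_lt_one]; linarith, LipschitzWith.of_dist_le_mul fun y z => ?_⟩
  rw [dist_eq_norm, dist_eq_norm, Real.coe_toNNReal _ (nonneg_of_mem_goodData hx),
    bridgeMap_apply, bridgeMap_apply, ← smul_sub, ← Finset.sum_sub_distrib]
  simp_rw [← sub_smul, ← mul_sub]
  refine norm_average_le_of_mem_goodData hx fun j => ?_
  rw [abs_mul, inner_sub_right]
  exact (mul_le_of_le_one_left (abs_nonneg _) (abs_update_one_le_one i ht j)).trans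
    (hlip.dist_le_mul _ _)

lemma existsUnique_bridgeMap (hlip : LipschitzWith lam f) (hε : 0 < ε)
    (hx : x ∈ goodData n p lam ε) (i : Fin n) {t : ℝ} (ht : t ∈ Set.Icc (0 : ℝ) 1) :
    ∃! y, y = bridgeMap f x i t y :=
  existsUnique_fixedPoint (contractingWith_bridgeMap hlip hε hx i ht)

lemma existsUnique_leaveOneOutMap (hlip : LipschitzWith lam f) (hε : 0 < ε)
    (hx : x ∈ goodData n p lam ε) (i : Fin n) : ∃! y, y = leaveOneOutMap f x i y := by
  rw [leaveOneOutMap_eq_bridgeMap_zero]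
  exact existsUnique_bridgeMap hlip hε hx i ⟨le_rfl, zero_le_one⟩

lemma existsUnique_regressionMap (hlip : LipschitzWith lam f) (hε : 0 < ε)
    (hx : x ∈ goodData n p lam ε) : ∃! y, y = regressionMap f x y := by
  rcases n.eq_zero_or_pos with rfl | hn
  · simp [regressionMap]
  · rw [regressionMap_eq_bridgeMap_one f x ⟨0, hn⟩]
    exact existsUnique_bridgeMap hlip hε hx _ ⟨zero_le_one, le_rfl⟩

lemma bridgeMap_bridge (hlip : LipschitzWith lam f) (hε : 0 < ε)
    (hx : x ∈ goodData n p lam ε) (i : Fin n) {t : ℝ} (ht : t ∈ Set.Icc (0 : ℝ) 1) :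
    bridgeMap f x i t (bridge f x i t) = bridge f x i t :=
  (uniqueFixedPoint_spec (existsUnique_bridgeMap hlip hε hx i ht)).symm

lemma norm_bridge_sub_le (hlip : LipschitzWith lam f) (hε : 0 < ε)
    (hx : x ∈ goodData n p lam ε) (i : Fin n) {t : ℝ} (ht : t ∈ Set.Icc (0 : ℝ) 1)
    (z : EuclideanSpace ℝ (Fin p)) :
    ‖bridge f x i t - z‖ ≤ ε⁻¹ * ‖bridgeMap f x i t z - z‖ := by
  have h := norm_uniqueFixedPoint_sub_le (contractingWith_bridgeMap hlip hε hx i ht) z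
  rwa [Real.coe_toNNReal _ (nonneg_of_mem_goodData hx), sub_sub_cancel, div_eq_inv_mul] at h

lemma norm_bridge_sub_bridge_le (hlip : LipschitzWith lam f) (hε : 0 < ε)
    (hx : x ∈ goodData n p lam ε) (i : Fin n) {s t : ℝ} (hs : s ∈ Set.Icc (0 : ℝ) 1)
    (ht : t ∈ Set.Icc (0 : ℝ) 1) :
    ‖bridge f x i t - bridge f x i s‖
      ≤ ε⁻¹ * (|t - s| / n * (|f (inner ℝ (x i) (bridge f x i s))| * ‖x i‖)) := by
  refine (norm_bridge_sub_le hlip hε hx i ht _).trans (le_of_eq ?_)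
  have hdiff : bridgeMap f x i t (bridge f x i s) - bridge f x i s
      = ((t - s) / n) • f (inner ℝ (x i) (bridge f x i s)) • x i := by
    nth_rewrite 2 [← bridgeMap_bridge hlip hε hx i hs]
    rw [bridgeMap, bridgeMap, add_sub_add_left_eq_sub, ← sub_smul, sub_div]
  rw [hdiff, norm_smul, norm_smul, Real.norm_eq_abs, Real.norm_eq_abs, abs_div, Nat.abs_cast]

lemma norm_leaveOneOut_le (hlip : LipschitzWith lam f) (hlam : 0 < lam) (hε : 0 < ε)
    (hx : x ∈ goodData n p lam ε) (i : Fin n) :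
    ‖leaveOneOut f x i‖ ≤ ε⁻¹ * (|f 0| * √(lam : ℝ)⁻¹) := by
  have h0 : (0 : ℝ) ∈ Set.Icc (0 : ℝ) 1 := ⟨le_rfl, zero_le_one⟩
  have hn : (0 : ℝ) < n := by exact_mod_cast i.pos
  have h := norm_bridge_sub_le hlip hε hx i h0 0
  rw [← leaveOneOut_eq_bridge_zero, sub_zero, sub_zero] at h
  refine h.trans (mul_le_mul_of_nonneg_left ?_ (by positivity))
  set a : EuclideanSpace ℝ (Fin n) :=
    WithLp.toLp 2 fun j => Function.update (1 : Fin n → ℝ) i 0 j * f 0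
  have ha : ‖a‖ ≤ √n * |f 0| := by
    refine le_of_sq_le_sq ?_ (by positivity)
    rw [EuclideanSpace.norm_sq_eq, mul_pow, Real.sq_sqrt hn.le]
    refine (Finset.sum_le_card_nsmul _ _ (|f 0| ^ 2) fun j _ => ?_).trans (by simp)
    refine pow_le_pow_left₀ (norm_nonneg _) ?_ 2
    rw [Real.norm_eq_abs, abs_mul]
    exact mul_le_of_le_one_left (abs_nonneg _) (abs_update_one_le_one i h0 j)
  calc ‖bridgeMap f x i 0 0‖ = (n : ℝ)⁻¹ * ‖∑ j, a j • x j‖ := by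
        simp [bridgeMap_apply, norm_smul, a]
    _ ≤ (n : ℝ)⁻¹ * (√(n / lam) * (√n * |f 0|)) := by
        gcongr
        refine (norm_sum_smul_le x a).trans ?_
        gcongr
        exact norm_analysis_le_of_mem_goodData hlam hε hx
    _ = |f 0| * √(lam : ℝ)⁻¹ := by
        rw [div_eq_mul_inv, Real.sqrt_mul hn.le]
        field_simp
        rw [Real.sq_sqrt hn.le]

lemma continuousOn_bridge (hlip : LipschitzWith lam f) (hε : 0 < ε) (i : Fin n) :
    ContinuousOn (Function.uncurry fun (x : Fin n → EuclideanSpace ℝ (Fin p)) t => bridge f x i t)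
      (goodData n p lam ε ×ˢ Set.Icc 0 1) := by
  refine continuousOn_uniqueFixedPoint
    (fun q hq => contractingWith_bridgeMap hlip hε hq.1 i hq.2) fun y => ?_
  have hf := hlip.continuous
  unfold bridgeMap leaveOneOutMap
  fun_prop

lemma continuousOn_bridge_left (hlip : LipschitzWith lam f) (hε : 0 < ε) (i : Fin n) {t : ℝ}
    (ht : t ∈ Set.Icc (0 : ℝ) 1) :
    ContinuousOn (fun x : Fin n → EuclideanSpace ℝ (Fin p) => bridge f x i t)
      (goodData n p lam ε) :=
  (continuousOn_bridge hlip hε i).uncurry_right t ht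

lemma continuousOn_bridge_right (hlip : LipschitzWith lam f) (hε : 0 < ε)
    (hx : x ∈ goodData n p lam ε) (i : Fin n) : ContinuousOn (bridge f x i) (Set.Icc 0 1) :=
  (continuousOn_bridge hlip hε i).uncurry_left x hx

lemma continuousOn_leaveOneOut (hlip : LipschitzWith lam f) (hε : 0 < ε) (i : Fin n) :
    ContinuousOn (fun x : Fin n → EuclideanSpace ℝ (Fin p) => leaveOneOut f x i)
      (goodData n p lam ε) := by
  simp_rw [leaveOneOut_eq_bridge_zero]
  exact continuousOn_bridge_left hlip hε i ⟨le_rfl, zero_le_one⟩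

end Bridge

section Resolvent

variable {n p : ℕ}

/-- `Q₋ᵢ` as an operator on Euclidean space. -/
abbrev resolventCLM (f : ℝ → ℝ) (x : Fin n → EuclideanSpace ℝ (Fin p)) (i : Fin n) :
    EuclideanSpace ℝ (Fin p) →L[ℝ] EuclideanSpace ℝ (Fin p) :=
  Matrix.toEuclideanCLM (𝕜 := ℝ) (n := Fin p) (resolvent f x i)

/-- `Q₋ᵢ⁻¹` as an operator on Euclidean space. -/
abbrev preResolventCLM (f : ℝ → ℝ) (x : Fin n → EuclideanSpace ℝ (Fin p)) (i : Fin n) :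
    EuclideanSpace ℝ (Fin p) →L[ℝ] EuclideanSpace ℝ (Fin p) :=
  Matrix.toEuclideanCLM (𝕜 := ℝ) (n := Fin p) (preResolvent f x i)

lemma preResolventCLM_apply (f : ℝ → ℝ) (x : Fin n → EuclideanSpace ℝ (Fin p)) (i : Fin n)
    (v : EuclideanSpace ℝ (Fin p)) :
    preResolventCLM f x i v = v - (1 / (n : ℝ)) • ∑ j,
      ((if j = i then 0 else deriv f (inner ℝ (x j) (leaveOneOut f x i))) * inner ℝ (x j) v)
        • x j := by
  rw [preResolventCLM, preResolvent, map_sub, map_smul, map_one,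
    ← toEuclideanCLM_dataMatrix_mul_diagonal_mul_transpose]
  rfl

lemma resolvent_update (f : ℝ → ℝ) (x : Fin n → EuclideanSpace ℝ (Fin p)) (i : Fin n)
    (v : EuclideanSpace ℝ (Fin p)) :
    resolvent f (Function.update x i v) i = resolvent f x i := by
  have hpre : preResolventCLM f (Function.update x i v) i = preResolventCLM f x i := by
    ext1 u
    rw [preResolventCLM_apply, preResolventCLM_apply, leaveOneOut_update]
    congr 2
    refine Finset.sum_congr rfl fun j _ => ?_
    rcases eq_or_ne j i with rfl | hj
    · simp
    · rw [Function.update_of_ne hj]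
  rw [resolvent, resolvent, EquivLike.injective (Matrix.toEuclideanCLM (𝕜 := ℝ)) hpre]

variable {f : ℝ → ℝ} {lam : ℝ≥0} {ε : ℝ} {x : Fin n → EuclideanSpace ℝ (Fin p)}

lemma le_norm_preResolventCLM (hlip : LipschitzWith lam f) (hx : x ∈ goodData n p lam ε)
    (i : Fin n) (v : EuclideanSpace ℝ (Fin p)) : ε * ‖v‖ ≤ ‖preResolventCLM f x i v‖ := by
  rw [preResolventCLM_apply]
  have havg : ‖(1 / (n : ℝ)) • ∑ j,
      ((if j = i then 0 else deriv f (inner ℝ (x j) (leaveOneOut f x i))) * inner ℝ (x j) v)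
        • x j‖ ≤ (1 - ε) * ‖v‖ := by
    refine norm_average_le_of_mem_goodData hx fun j => ?_
    rw [abs_mul]
    gcongr
    split_ifs
    · simp
    · exact norm_deriv_le_of_lipschitz hlip
  linarith [norm_sub_norm_le v ((1 / (n : ℝ)) • ∑ j,
    ((if j = i then 0 else deriv f (inner ℝ (x j) (leaveOneOut f x i))) * inner ℝ (x j) v) • x j)]

lemma isUnit_preResolvent (hlip : LipschitzWith lam f) (hε : 0 < ε)
    (hx : x ∈ goodData n p lam ε) (i : Fin n) : IsUnit (preResolvent f x i) := by
  rw [← Matrix.mulVec_injective_iff_isUnit]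
  intro v w hvw
  have h := le_norm_preResolventCLM hlip hx i (WithLp.toLp 2 v - WithLp.toLp 2 w)
  rw [map_sub, Matrix.toEuclideanCLM_toLp, Matrix.toEuclideanCLM_toLp, hvw, sub_self,
    norm_zero] at h
  have hnorm : ‖WithLp.toLp 2 v - WithLp.toLp 2 w‖ ≤ 0 := nonpos_of_mul_nonpos_right h hε
  exact WithLp.toLp_injective 2 (sub_eq_zero.1 (norm_le_zero_iff.1 hnorm))

lemma preResolventCLM_resolventCLM (hlip : LipschitzWith lam f) (hε : 0 < ε)
    (hx : x ∈ goodData n p lam ε) (i : Fin n) (v : EuclideanSpace ℝ (Fin p)) :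
    preResolventCLM f x i (resolventCLM f x i v) = v := by
  have hdet := (Matrix.isUnit_iff_isUnit_det _).1 (isUnit_preResolvent hlip hε hx i)
  rw [preResolventCLM, resolventCLM, ← mul_apply_eq_comp, ← map_mul, resolvent,
    Matrix.mul_nonsing_inv _ hdet, map_one, one_apply_eq_self]

lemma norm_resolventCLM_apply_le (hlip : LipschitzWith lam f) (hε : 0 < ε)
    (hx : x ∈ goodData n p lam ε) (i : Fin n) (v : EuclideanSpace ℝ (Fin p)) :
    ‖resolventCLM f x i v‖ ≤ ε⁻¹ * ‖v‖ := by
  have h := le_norm_preResolventCLM hlip hx i (resolventCLM f x i v)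
  rw [preResolventCLM_resolventCLM hlip hε hx] at h
  rwa [inv_mul_eq_div, le_div_iff₀' hε]

variable (n p) in
lemma continuous_dataMatrix :
    Continuous fun x : Fin n → EuclideanSpace ℝ (Fin p) => dataMatrix x := by
  refine continuous_matrix fun a j => ?_
  simp only [dataMatrix, Matrix.of_apply]
  fun_prop

lemma continuousOn_preResolvent (hlip : LipschitzWith lam f) (hf' : Continuous (deriv f))
    (hε : 0 < ε) (i : Fin n) :
    ContinuousOn (fun x : Fin n → EuclideanSpace ℝ (Fin p) => preResolvent f x i)
      (goodData n p lam ε) := by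
  have hX := continuous_dataMatrix n p
  have hY := continuousOn_leaveOneOut (p := p) hlip hε i
  have hjoint :
      Continuous fun q : (Fin n → EuclideanSpace ℝ (Fin p)) × EuclideanSpace ℝ (Fin p) =>
        1 - (1 / (n : ℝ)) • (dataMatrix q.1 * Matrix.diagonal (fun j =>
          if j = i then 0 else deriv f (inner ℝ (q.1 j) q.2)) * (dataMatrix q.1).transpose) := by
    have hdiag :
        Continuous fun q : (Fin n → EuclideanSpace ℝ (Fin p)) × EuclideanSpace ℝ (Fin p) =>
          Matrix.diagonal fun j => if j = i then 0 else deriv f (inner ℝ (q.1 j) q.2) := by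
      refine Continuous.matrix_diagonal (continuous_pi fun j => ?_)
      split_ifs <;> fun_prop
    fun_prop
  have h := hjoint.comp_continuousOn (continuousOn_id.prodMk hY)
  exact h

lemma continuousOn_resolventCLM (hlip : LipschitzWith lam f) (hf' : Continuous (deriv f))
    (hε : 0 < ε) (i : Fin n) :
    ContinuousOn (fun x : Fin n → EuclideanSpace ℝ (Fin p) => resolventCLM f x i)
      (goodData n p lam ε) := by
  have hCLM : Continuous (Matrix.toEuclideanCLM (𝕜 := ℝ) (n := Fin p)) :=
    LinearMap.continuous_of_finiteDimensional
      (Matrix.toEuclideanCLM (𝕜 := ℝ) (n := Fin p)).toAlgEquiv.toLinearMap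
  refine hCLM.comp_continuousOn (f := fun x => resolvent f x i) fun x hx => ?_
  obtain ⟨u, hu⟩ := (Matrix.isUnit_iff_isUnit_det _).1 (isUnit_preResolvent hlip hε hx i)
  have hinv : ContinuousAt Inv.inv (preResolvent f x i) :=
    continuousAt_matrix_inv _ (hu ▸ NormedRing.inverse_continuousAt u)
  exact hinv.comp_continuousWithinAt (f := fun x => preResolvent f x i)
    (continuousOn_preResolvent hlip hf' hε i x hx)

lemma continuousOn_residualNorm (hlip : LipschitzWith lam f) (hf' : Continuous (deriv f))
    (hε : 0 < ε) (i : Fin n) :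
    ContinuousOn (fun x : Fin n → EuclideanSpace ℝ (Fin p) => residualNorm f x i)
      (goodData n p lam ε) := by
  simp_rw [residualNorm, regressor_eq_bridge_one f _ i]
  have hY := continuousOn_bridge_left (p := p) hlip hε i (t := 1) ⟨zero_le_one, le_rfl⟩
  have hYi := continuousOn_leaveOneOut (p := p) hlip hε i
  have hcol : ContinuousOn (fun x : Fin n → EuclideanSpace ℝ (Fin p) => x i)
      (goodData n p lam ε) := (continuous_apply i).continuousOn
  have hQ := (continuousOn_resolventCLM (p := p) hlip hf' hε i).clm_apply hcol
  have hfY := hlip.continuous.comp_continuousOn (hcol.inner (𝕜 := ℝ) hY)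
  exact ((hY.sub hYi).sub ((hfY.smul hQ).const_smul (1 / (n : ℝ)))).norm

end Resolvent

section Quartic

instance fact_one_le_four : Fact ((1 : ℝ≥0∞) ≤ 4) := ⟨by norm_num⟩

variable {ι E : Type*} [NormedAddCommGroup E] [InnerProductSpace ℝ E]

lemma norm_pow_four_eq_sum [Fintype ι] (a : PiLp 4 fun _ : ι => ℝ) : ‖a‖ ^ 4 = ∑ j, a j ^ 4 := by
  have hsum : 0 ≤ ∑ j, ‖a j‖ ^ 4 := Finset.sum_nonneg fun j _ => by positivity
  rw [PiLp.norm_eq_of_nat 4 (by norm_num), one_div, Real.rpow_inv_natCast_pow hsum (by norm_num)]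
  simp only [Real.norm_eq_abs, Even.pow_abs (by decide : Even 4)]

/-- The analysis operator `y ↦ (xⱼᵀ y)ⱼ` with values in `ℓ⁴`: second-order Taylor remainders are
quadratic in `xⱼᵀ y`, so that their `ℓ²` norm is an `ℓ⁴` norm of `(xⱼᵀ y)ⱼ`. -/
def quarticAnalysis (x : ι → E) : E →L[ℝ] PiLp 4 (fun _ : ι => ℝ) :=
  (PiLp.continuousLinearEquiv 4 ℝ fun _ : ι => ℝ).symm.toContinuousLinearMap ∘L
    ContinuousLinearMap.pi fun j => innerSL ℝ (x j)

@[simp]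
lemma quarticAnalysis_apply (x : ι → E) (y : E) (j : ι) :
    quarticAnalysis x y j = inner ℝ (x j) y := rfl

lemma continuous_quarticAnalysis_apply :
    Continuous fun q : (ι → E) × E => quarticAnalysis q.1 q.2 := by
  refine (PiLp.continuous_toLp 4 _).comp (continuous_pi fun j => ?_)
  change Continuous fun q : (ι → E) × E => inner ℝ (q.1 j) q.2
  fun_prop

variable [Fintype ι]

lemma norm_quarticAnalysis_le (x : ι → E) : ‖quarticAnalysis x‖ ≤ ‖analysis x‖ := by
  refine ContinuousLinearMap.opNorm_le_bound _ (norm_nonneg _) fun y =>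
    le_trans ?_ ((analysis x).le_opNorm y)
  refine le_of_pow_le_pow_left₀ four_ne_zero (norm_nonneg _) ?_
  calc ‖quarticAnalysis x y‖ ^ 4 = ∑ j, (inner ℝ (x j) y ^ 2) ^ 2 := by
        simp only [norm_pow_four_eq_sum, quarticAnalysis_apply, ← pow_mul]
    _ ≤ (∑ j, inner ℝ (x j) y ^ 2) ^ 2 :=
        Finset.sum_sq_le_sq_sum_of_nonneg fun j _ => sq_nonneg _
    _ = ‖analysis x y‖ ^ 4 := by rw [← norm_analysis_apply_sq, ← pow_mul]

lemma norm_sum_smul_le_of_abs_le_sq [CompleteSpace E] (x z : ι → E) {a : ι → ℝ} {l : ℝ} {v : E}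
    (hl : 0 ≤ l) (ha : ∀ j, |a j| ≤ l * inner ℝ (z j) v ^ 2) :
    ‖∑ j, a j • x j‖ ≤ ‖analysis x‖ * (l * ‖quarticAnalysis z v‖ ^ 2) := by
  have hcoef : ‖WithLp.toLp 2 a‖ ≤ l * ‖quarticAnalysis z v‖ ^ 2 := by
    refine le_of_sq_le_sq ?_ (by positivity)
    rw [mul_pow, ← pow_mul, norm_pow_four_eq_sum, EuclideanSpace.norm_sq_eq, Finset.mul_sum]
    refine Finset.sum_le_sum fun j _ => ?_
    calc ‖a j‖ ^ 2 ≤ (l * inner ℝ (z j) v ^ 2) ^ 2 := pow_le_pow_left₀ (norm_nonneg _) (ha j) 2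
      _ = l ^ 2 * quarticAnalysis z v j ^ 4 := by rw [quarticAnalysis_apply]; ring
  exact (norm_sum_smul_le x (WithLp.toLp 2 a)).trans (by gcongr)

end Quartic

section CrossForms

variable {n p : ℕ}

/-- The forms `v ↦ (xⱼᵀ Q₋ᵢ v)_{j ≠ i}` with values in `ℓ⁴`. They only depend on the columns
`xⱼ`, `j ≠ i`, hence are independent of `xᵢ`. -/
def crossForms (f : ℝ → ℝ) (x : Fin n → EuclideanSpace ℝ (Fin p)) (i : Fin n) :
    EuclideanSpace ℝ (Fin p) →L[ℝ] PiLp 4 (fun _ : Fin n => ℝ) :=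
  quarticAnalysis (Function.update x i 0) ∘L resolventCLM f x i

lemma crossForms_update (f : ℝ → ℝ) (x : Fin n → EuclideanSpace ℝ (Fin p)) (i : Fin n)
    (v : EuclideanSpace ℝ (Fin p)) : crossForms f (Function.update x i v) i = crossForms f x i := by
  rw [crossForms, crossForms, Function.update_idem, resolventCLM, resolvent_update]

variable {f : ℝ → ℝ} {lam : ℝ≥0} {ε : ℝ} {x : Fin n → EuclideanSpace ℝ (Fin p)}

lemma norm_quarticAnalysis_update_le (hlam : 0 < lam) (hε : 0 < ε)
    (hx : x ∈ goodData n p lam ε) (i : Fin n) :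
    ‖quarticAnalysis (Function.update x i 0)‖ ≤ √(n / lam) :=
  (norm_quarticAnalysis_le _).trans
    (norm_analysis_le_of_mem_goodData hlam hε (update_zero_mem_goodData hx i))

lemma norm_crossForms_le (hlip : LipschitzWith lam f) (hlam : 0 < lam) (hε : 0 < ε)
    (hx : x ∈ goodData n p lam ε) (i : Fin n) : ‖crossForms f x i‖ ≤ √(n / lam) / ε := by
  refine (ContinuousLinearMap.opNorm_comp_le _ _).trans (mul_le_mul
    (norm_quarticAnalysis_update_le hlam hε hx i) ?_ (norm_nonneg _) (by positivity))
  exact ContinuousLinearMap.opNorm_le_bound _ (by positivity)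
    (norm_resolventCLM_apply_le hlip hε hx i)

lemma continuousOn_norm_crossForms (hlip : LipschitzWith lam f) (hf' : Continuous (deriv f))
    (hε : 0 < ε) (i : Fin n) :
    ContinuousOn (fun q : (Fin n → EuclideanSpace ℝ (Fin p)) × EuclideanSpace ℝ (Fin p) =>
      ‖crossForms f q.1 i q.2‖) (goodData n p lam ε ×ˢ Set.univ) := by
  have hQ : ContinuousOn
      (fun q : (Fin n → EuclideanSpace ℝ (Fin p)) × EuclideanSpace ℝ (Fin p) =>
        resolventCLM f q.1 i q.2) (goodData n p lam ε ×ˢ Set.univ) :=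
    ((continuousOn_resolventCLM hlip hf' hε i).comp continuousOn_fst fun q hq => hq.1).clm_apply
      continuousOn_snd
  have hupdate : Continuous
      fun q : (Fin n → EuclideanSpace ℝ (Fin p)) × EuclideanSpace ℝ (Fin p) =>
        Function.update q.1 i 0 := continuous_fst.update i continuous_const
  have h := (continuous_quarticAnalysis_apply.comp_continuousOn
    (hupdate.continuousOn.prodMk hQ)).norm
  exact h

end CrossForms

section Expansion

lemma abs_taylor_le {f : ℝ → ℝ} (hf : Differentiable ℝ f) {L : ℝ≥0}
    (hL : LipschitzWith L (deriv f)) (u v : ℝ) :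
    |f v - f u - deriv f u * (v - u)| ≤ L * (v - u) ^ 2 := by
  have hderiv : ∀ s, HasDerivAt (fun s => f s - deriv f u * s) (deriv f s - deriv f u) s :=
    fun s => by simpa using (hf s).hasDerivAt.fun_sub ((hasDerivAt_id' s).const_mul (deriv f u))
  have h := Convex.norm_image_sub_le_of_norm_deriv_le (f := fun s => f s - deriv f u * s)
    (s := Set.uIcc u v) (C := L * |v - u|) (fun s _ => (hderiv s).differentiableAt) (fun s hs => by
      rw [(hderiv s).deriv]
      exact (hL.dist_le_mul s u).trans
        (mul_le_mul_of_nonneg_left (Set.abs_sub_left_of_mem_uIcc hs) L.coe_nonneg))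
    (convex_uIcc u v) Set.left_mem_uIcc Set.right_mem_uIcc
  rw [Real.norm_eq_abs, Real.norm_eq_abs, mul_assoc, abs_mul_abs_self, ← sq] at h
  convert h using 2
  ring

/-- The two alternatives `R 1 ≤ 2 α` and `1 ≤ 4 α β` are combined in one bound: by continuity, `R`
either stays below `1 / (2 β)`, where the quadratic term is absorbed, or takes this value. -/
lemma le_of_le_add_mul_sq {R : ℝ → ℝ} {α β : ℝ} (hcont : ContinuousOn R (Set.Icc 0 1))
    (hnonneg : ∀ t, 0 ≤ R t) (hzero : R 0 = 0) (hβ : 0 ≤ β)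
    (hquad : ∀ t ∈ Set.Icc (0 : ℝ) 1, R t ≤ α + β * R t ^ 2) :
    R 1 ≤ 2 * α * (1 + 2 * β * R 1) := by
  have hα : 0 ≤ α := by simpa [hzero] using hquad 0 ⟨le_rfl, zero_le_one⟩
  have h1 := hnonneg 1
  rcases le_or_gt (2 * β * R 1) 1 with hsmall | hlarge
  · have hquad1 := hquad 1 ⟨zero_le_one, le_rfl⟩
    have : 0 ≤ α * (β * R 1) := by positivity
    nlinarith
  · have hβ' : 0 < β := by
      refine hβ.lt_of_ne fun h => ?_
      rw [← h] at hlarge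
      linarith
    have hmem : 1 / (2 * β) ∈ Set.Icc (R 0) (R 1) := by
      rw [hzero, Set.mem_Icc, div_le_iff₀ (by positivity)]
      exact ⟨by positivity, by linarith⟩
    obtain ⟨t, ht, hRt⟩ := intermediate_value_Icc zero_le_one hcont hmem
    have halt : 1 ≤ 4 * α * β := by
      have h := hquad t ht
      rw [hRt] at h
      field_simp at h
      linarith
    nlinarith

variable {n p : ℕ}

/-- `y₋ᵢ(t) - Y₋ᵢ - (t/n) f(xᵢᵀ y₋ᵢ(t)) Q₋ᵢ xᵢ`, which interpolates between `0` and the vector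
whose norm is `residualNorm`. -/
def bridgeResidual (f : ℝ → ℝ) (x : Fin n → EuclideanSpace ℝ (Fin p)) (i : Fin n) (t : ℝ) :
    EuclideanSpace ℝ (Fin p) :=
  bridge f x i t - leaveOneOut f x i -
    (t / (n : ℝ)) • f (inner ℝ (x i) (bridge f x i t)) • resolventCLM f x i (x i)

lemma residualNorm_eq_norm_bridgeResidual_one (f : ℝ → ℝ) (x : Fin n → EuclideanSpace ℝ (Fin p))
    (i : Fin n) : residualNorm f x i = ‖bridgeResidual f x i 1‖ := by
  rw [residualNorm, bridgeResidual, regressor_eq_bridge_one f x i]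

lemma bridgeResidual_zero (f : ℝ → ℝ) (x : Fin n → EuclideanSpace ℝ (Fin p)) (i : Fin n) :
    bridgeResidual f x i 0 = 0 := by
  rw [bridgeResidual, leaveOneOut_eq_bridge_zero, sub_self, zero_div, zero_smul, sub_zero]

lemma leaveOneOutMap_apply (f : ℝ → ℝ) (x : Fin n → EuclideanSpace ℝ (Fin p)) (i : Fin n)
    (y : EuclideanSpace ℝ (Fin p)) :
    leaveOneOutMap f x i y
      = (1 / (n : ℝ)) • ∑ j, (if j = i then 0 else f (inner ℝ (x j) y)) • x j := by
  rw [leaveOneOutMap, ← Finset.sum_erase_add _ _ (Finset.mem_univ i), if_pos rfl, zero_smul,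
    add_zero]
  congr 1
  exact Finset.sum_congr rfl fun j hj => by rw [if_neg (Finset.ne_of_mem_erase hj)]

variable {f : ℝ → ℝ} {lam L : ℝ≥0} {ε B : ℝ} {x : Fin n → EuclideanSpace ℝ (Fin p)}

lemma continuousOn_bridgeResidual (hlip : LipschitzWith lam f) (hε : 0 < ε)
    (hx : x ∈ goodData n p lam ε) (i : Fin n) :
    ContinuousOn (bridgeResidual f x i) (Set.Icc 0 1) := by
  have hy := continuousOn_bridge_right hlip hε hx i
  have hfy : ContinuousOn (fun t => f (inner ℝ (x i) (bridge f x i t))) (Set.Icc 0 1) :=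
    hlip.continuous.comp_continuousOn (continuousOn_const.inner hy)
  exact (hy.sub continuousOn_const).sub
    ((continuousOn_id.div_const (n : ℝ)).smul (hfy.smul continuousOn_const))

lemma preResolventCLM_bridgeResidual (hlip : LipschitzWith lam f) (hε : 0 < ε)
    (hx : x ∈ goodData n p lam ε) (i : Fin n) {t : ℝ} (ht : t ∈ Set.Icc (0 : ℝ) 1) :
    preResolventCLM f x i (bridgeResidual f x i t)
      = (1 / (n : ℝ)) • ∑ j, (if j = i then 0 else
        f (inner ℝ (x j) (bridge f x i t)) - f (inner ℝ (x j) (leaveOneOut f x i))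
          - deriv f (inner ℝ (x j) (leaveOneOut f x i))
            * inner ℝ (x j) (bridge f x i t - leaveOneOut f x i)) • x j := by
  rw [bridgeResidual, map_sub, map_smul, map_smul, preResolventCLM_resolventCLM hlip hε hx,
    preResolventCLM_apply]
  have hbridge := bridgeMap_bridge hlip hε hx i ht
  have hleave := bridgeMap_bridge hlip hε hx i (t := 0) ⟨le_rfl, zero_le_one⟩
  rw [← leaveOneOutMap_eq_bridgeMap_zero, ← leaveOneOut_eq_bridge_zero] at hleave
  rw [bridgeMap] at hbridge
  set y := bridge f x i t
  set z := leaveOneOut f x i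
  have hdiff : y - z - (t / (n : ℝ)) • f (inner ℝ (x i) y) • x i
      = leaveOneOutMap f x i y - leaveOneOutMap f x i z := by
    nth_rewrite 1 [← hbridge]
    rw [hleave]
    abel
  rw [sub_right_comm, hdiff, leaveOneOutMap_apply, leaveOneOutMap_apply, ← smul_sub, ← smul_sub,
    ← Finset.sum_sub_distrib, ← Finset.sum_sub_distrib]
  congr 1
  refine Finset.sum_congr rfl fun j _ => ?_
  rw [← sub_smul, ← sub_smul]
  congr 1
  split_ifs <;> ring

lemma mul_sqrt_natCast_div_sq (hlam : 0 < lam) : (lam : ℝ) * √(n / lam) ^ 2 = n := by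
  rw [Real.sq_sqrt (by positivity), mul_div_cancel₀ _ (by positivity)]

lemma norm_bridgeResidual_le (hf : Differentiable ℝ f) (hlip : LipschitzWith lam f)
    (hL : LipschitzWith L (deriv f)) (hlam : 0 < lam) (hε : 0 < ε)
    (hx : x ∈ goodData n p lam ε) (i : Fin n) {t : ℝ} (ht : t ∈ Set.Icc (0 : ℝ) 1) :
    ‖bridgeResidual f x i t‖ ≤ L / (ε * lam) / √(n / lam) *
      ‖quarticAnalysis (Function.update x i 0) (bridge f x i t - leaveOneOut f x i)‖ ^ 2 := by
  have hn : (0 : ℝ) < n := by exact_mod_cast i.pos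
  have hlower := le_norm_preResolventCLM hlip hx i (bridgeResidual f x i t)
  rw [preResolventCLM_bridgeResidual hlip hε hx i ht, norm_smul,
    Real.norm_of_nonneg (by positivity)] at hlower
  set y := bridge f x i t
  set z := leaveOneOut f x i
  have hsum := norm_sum_smul_le_of_abs_le_sq x (Function.update x i 0) (v := y - z) (a := fun j =>
    if j = i then 0 else f (inner ℝ (x j) y) - f (inner ℝ (x j) z)
      - deriv f (inner ℝ (x j) z) * inner ℝ (x j) (y - z)) L.coe_nonneg fun j => by
      rcases eq_or_ne j i with rfl | hj
      · simp
      · simp only [if_neg hj, Function.update_of_ne hj, inner_sub_right]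
        exact abs_taylor_le hf hL _ _
  set q := ‖quarticAnalysis (Function.update x i 0) (y - z)‖
  calc ‖bridgeResidual f x i t‖ ≤ 1 / n * (√(n / lam) * (L * q ^ 2)) / ε := by
        rw [le_div_iff₀' hε]
        refine hlower.trans (mul_le_mul_of_nonneg_left (hsum.trans ?_) (by positivity))
        gcongr
        exact norm_analysis_le_of_mem_goodData hlam hε hx
    _ = L / (ε * lam) / √(n / lam) * q ^ 2 := by
        nth_rewrite 1 [← mul_sqrt_natCast_div_sq (n := n) hlam]
        field_simp

lemma norm_div_natCast_smul_apply_smul_le (hB : ∀ u, |f u| ≤ B) {t : ℝ}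
    (ht : t ∈ Set.Icc (0 : ℝ) 1) (u : ℝ) {E : Type*} [NormedAddCommGroup E] [NormedSpace ℝ E]
    (v : E) :
    ‖(t / (n : ℝ)) • f u • v‖ ≤ B / n * ‖v‖ := by
  rw [norm_smul, norm_smul, Real.norm_eq_abs, Real.norm_eq_abs, abs_div, Nat.abs_cast,
    abs_of_nonneg ht.1, ← mul_assoc, div_mul_eq_mul_div]
  gcongr
  exact (mul_le_of_le_one_left (abs_nonneg _) ht.2).trans (hB u)

lemma natCast_mul_residualNorm_le (hlip : LipschitzWith lam f) (hlam : 0 < lam) (hε : 0 < ε)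
    (hB : ∀ u, |f u| ≤ B) (hx : x ∈ goodData n p lam ε) (i : Fin n) :
    n * residualNorm f x i ≤ 2 * B / ε * √(n / lam) := by
  have hB₀ : 0 ≤ B := (abs_nonneg _).trans (hB 0)
  have hn : (0 : ℝ) < n := by exact_mod_cast i.pos
  have hcol := norm_column_le_of_mem_goodData hlam hε hx i
  have hbridge : ‖bridge f x i 1 - leaveOneOut f x i‖ ≤ ε⁻¹ * (1 / n * (B * √(n / lam))) := by
    rw [leaveOneOut_eq_bridge_zero]
    refine (norm_bridge_sub_bridge_le hlip hε hx i (s := 0) (t := 1)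
      ⟨le_rfl, zero_le_one⟩ ⟨zero_le_one, le_rfl⟩).trans ?_
    rw [sub_zero, abs_one]
    gcongr
    exact hB _
  have hcorrection := (norm_div_natCast_smul_apply_smul_le (n := n) hB (t := 1)
    ⟨zero_le_one, le_rfl⟩ (inner ℝ (x i) (bridge f x i 1)) (resolventCLM f x i (x i))).trans
    (mul_le_mul_of_nonneg_left ((norm_resolventCLM_apply_le hlip hε hx i (x i)).trans
      (mul_le_mul_of_nonneg_left hcol (by positivity))) (by positivity))
  rw [residualNorm_eq_norm_bridgeResidual_one, bridgeResidual, ← le_div_iff₀' hn]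
  refine (norm_sub_le _ _).trans ((add_le_add hbridge hcorrection).trans_eq ?_)
  field_simp
  ring

lemma norm_bridgeResidual_le_add_sq (hf : Differentiable ℝ f) (hlip : LipschitzWith lam f)
    (hL : LipschitzWith L (deriv f)) (hlam : 0 < lam) (hε : 0 < ε) (hB : ∀ u, |f u| ≤ B)
    (hx : x ∈ goodData n p lam ε) (i : Fin n) {t : ℝ} (ht : t ∈ Set.Icc (0 : ℝ) 1) :
    ‖bridgeResidual f x i t‖
      ≤ 2 * (L / (ε * lam)) / √(n / lam) * (B / n * ‖crossForms f x i (x i)‖) ^ 2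
        + 2 * (L / (ε * lam)) * √(n / lam) * ‖bridgeResidual f x i t‖ ^ 2 := by
  have hn : (0 : ℝ) < n := by exact_mod_cast i.pos
  have hsplit : quarticAnalysis (Function.update x i 0) (bridge f x i t - leaveOneOut f x i)
      = (t / (n : ℝ)) • f (inner ℝ (x i) (bridge f x i t)) • crossForms f x i (x i)
        + quarticAnalysis (Function.update x i 0) (bridgeResidual f x i t) := by
    rw [crossForms, ContinuousLinearMap.comp_apply, ← map_smul, ← map_smul, ← map_add,
      bridgeResidual, add_sub_cancel]
  have hquartic : ‖quarticAnalysis (Function.update x i 0) (bridge f x i t - leaveOneOut f x i)‖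
      ≤ B / n * ‖crossForms f x i (x i)‖ + √(n / lam) * ‖bridgeResidual f x i t‖ := by
    rw [hsplit]
    exact (norm_add_le _ _).trans (add_le_add (norm_div_natCast_smul_apply_smul_le hB ht _ _)
      (ContinuousLinearMap.le_of_opNorm_le _ (norm_quarticAnalysis_update_le hlam hε hx i) _))
  calc ‖bridgeResidual f x i t‖
      ≤ L / (ε * lam) / √(n / lam) *
        (B / n * ‖crossForms f x i (x i)‖ + √(n / lam) * ‖bridgeResidual f x i t‖) ^ 2 :=
        (norm_bridgeResidual_le hf hlip hL hlam hε hx i ht).trans (by gcongr)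
    _ ≤ L / (ε * lam) / √(n / lam) *
        (2 * ((B / n * ‖crossForms f x i (x i)‖) ^ 2
          + (√(n / lam) * ‖bridgeResidual f x i t‖) ^ 2)) := by
        gcongr
        exact add_sq_le
    _ = _ := by
        field_simp

/-- The constant `D` in the bound `n ‖Y - Y₋ᵢ - (1/n) f(xᵢᵀ Y) Q₋ᵢ xᵢ‖ ≤ D h² / √(n/lam)`, where
`|f| ≤ B`, `f'` is `L`-Lipschitz and `(√(n/lam) / ε) h` bounds the `ℓ⁴` norm of
`(xⱼᵀ Q₋ᵢ xᵢ)_{j ≠ i}`. It combines the quadratic inequality for the residual with the crude bound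
`2 B √(n/lam) / ε`. -/
def expansionConst (lam ε L B : ℝ) : ℝ :=
  4 * (L / (ε * lam)) * lam * (B / (ε * lam)) ^ 2
    * (1 + 4 * (L / (ε * lam)) * (2 * B / (ε * lam)))

lemma expansionConst_nonneg (hε : 0 ≤ ε) (hB : 0 ≤ B) :
    0 ≤ expansionConst lam ε L B := by
  unfold expansionConst
  positivity

lemma natCast_mul_residualNorm_le_sq (hf : Differentiable ℝ f) (hlip : LipschitzWith lam f)
    (hL : LipschitzWith L (deriv f)) (hlam : 0 < lam) (hε : 0 < ε) (hB : ∀ u, |f u| ≤ B)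
    (hx : x ∈ goodData n p lam ε) {i : Fin n} {h : ℝ}
    (hcross : ‖crossForms f x i (x i)‖ ≤ √(n / lam) / ε * h) :
    n * residualNorm f x i ≤ expansionConst lam ε L B * h ^ 2 / √(n / lam) := by
  have hB₀ : 0 ≤ B := (abs_nonneg _).trans (hB 0)
  have hn : (0 : ℝ) < n := by exact_mod_cast i.pos
  have hg : 0 < √(n / lam : ℝ) := by positivity
  have hcrude := natCast_mul_residualNorm_le hlip hlam hε hB hx i
  have hbootstrap := le_of_le_add_mul_sq (continuousOn_bridgeResidual hlip hε hx i).norm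
    (fun t => norm_nonneg _) (by rw [bridgeResidual_zero, norm_zero]) (by positivity)
    fun t ht => norm_bridgeResidual_le_add_sq hf hlip hL hlam hε hB hx i ht
  rw [← residualNorm_eq_norm_bridgeResidual_one] at hbootstrap
  rw [← le_div_iff₀' hn] at hcrude ⊢
  refine hbootstrap.trans ?_
  calc _ ≤ 2 * (2 * (L / (ε * lam)) / √(n / lam) * (B / n * (√(n / lam) / ε * h)) ^ 2) *
        (1 + 2 * (2 * (L / (ε * lam)) * √(n / lam)) * (2 * B / ε * √(n / lam) / n)) := by
        have hR : 0 ≤ residualNorm f x i := norm_nonneg _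
        gcongr
    _ = expansionConst lam ε L B * h ^ 2 / √(n / lam) / n := by
        rw [expansionConst]
        set g := √(n / lam : ℝ)
        rw [← mul_sqrt_natCast_div_sq (n := n) hlam]
        field_simp
        ring

end Expansion

section Moments

variable {Ω : Type*} [MeasurableSpace Ω] {P : Measure Ω} {C c m : ℝ}

/-- A bound, depending on the constants only, for the `L^q` norm of a random variable `W` whose
tails satisfy `ℙ(|W| ≥ t) ≤ C e^{-(t/c)²}`. -/
def tailMoment (q C c : ℝ) : ℝ≥0∞ :=
  (ENNReal.ofReal q * ∫⁻ t in Set.Ioi (0 : ℝ),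
    ENNReal.ofReal (C * Real.exp (-(t / c) ^ 2)) * ENNReal.ofReal (t ^ (q - 1))) ^ (1 / q)

lemma tailMoment_ne_top {q : ℝ} (hq : 0 < q) (hC : 0 ≤ C) (hc : 0 < c) :
    tailMoment q C c ≠ ∞ := by
  refine ENNReal.rpow_ne_top_of_nonneg (by positivity)
    (ENNReal.mul_ne_top ENNReal.ofReal_ne_top ?_)
  have hint : IntegrableOn (fun t : ℝ => C * (t ^ (q - 1) * Real.exp (-(c ^ 2)⁻¹ * t ^ 2)))
      (Set.Ioi 0) :=
    ((integrable_rpow_mul_exp_neg_mul_sq (by positivity) (by linarith)).const_mul C).integrableOn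
  refine ne_of_lt (lt_of_le_of_lt (lintegral_mono fun t => le_of_eq ?_) hint.lintegral_lt_top)
  rw [← ENNReal.ofReal_mul (by positivity)]
  congr 1
  rw [show -(t / c) ^ 2 = -(c ^ 2)⁻¹ * t ^ 2 by ring]
  ring

lemma eLpNorm_le_tailMoment [IsFiniteMeasure P] {q : ℝ≥0∞} (hq : q ≠ 0) (hq' : q ≠ ∞)
    {W : Ω → ℝ} (hW : AEMeasurable W P)
    (htail : ∀ t : ℝ, 0 < t → P.real {ω | t ≤ |W ω|} ≤ C * Real.exp (-(t / c) ^ 2)) :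
    eLpNorm W q P ≤ tailMoment q.toReal C c := by
  have hq₀ : 0 < q.toReal := ENNReal.toReal_pos hq hq'
  rw [eLpNorm_eq_lintegral_rpow_enorm_toReal hq hq', tailMoment]
  refine ENNReal.rpow_le_rpow ?_ (by positivity)
  have henorm : ∀ ω, ‖W ω‖ₑ ^ q.toReal = ENNReal.ofReal (|W ω| ^ q.toReal) := fun ω => by
    rw [← ENNReal.ofReal_rpow_of_nonneg (abs_nonneg _) hq₀.le, Real.enorm_eq_ofReal_abs]
  simp_rw [henorm]
  rw [lintegral_rpow_eq_lintegral_meas_le_mul P (f := fun ω => |W ω|)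
    (.of_forall fun _ => abs_nonneg _) hW.abs hq₀]
  gcongr ENNReal.ofReal q.toReal * ?_
  refine setLIntegral_mono' measurableSet_Ioi fun t ht => ?_
  gcongr
  rw [← ofReal_measureReal]
  exact ENNReal.ofReal_le_ofReal (htail t ht)

lemma eLpNorm_piLp_le_of_forall {ι : Type*} [Fintype ι] {q : ℝ≥0∞} [Fact (1 ≤ q)] (hq : q ≠ ∞)
    {W : Ω → PiLp q fun _ : ι => ℝ} (hW : AEStronglyMeasurable W P) {δ : ℝ≥0∞}
    (hδ : ∀ j, eLpNorm (fun ω => W ω j) q P ≤ δ) :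
    eLpNorm W q P ≤ (Fintype.card ι : ℝ≥0∞) ^ (1 / q.toReal) * δ := by
  have hq₀ : q ≠ 0 := (zero_lt_one.trans_le Fact.out).ne'
  have hq_pos : 0 < q.toReal := ENNReal.toReal_pos hq₀ hq
  have hsum : ∀ ω, ‖W ω‖ₑ ^ q.toReal = ∑ j, ‖W ω j‖ₑ ^ q.toReal := fun ω => by
    simp only [enorm_eq_nnnorm, PiLp.nnnorm_eq_sum hq (W ω),
      ← ENNReal.coe_rpow_of_nonneg _ hq_pos.le, ← ENNReal.ofNNReal_finsetSum, ← NNReal.rpow_mul,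
      one_div_mul_cancel hq_pos.ne', NNReal.rpow_one]
  have hcoord : ∀ j, ∫⁻ ω, ‖W ω j‖ₑ ^ q.toReal ∂P ≤ δ ^ q.toReal := fun j => by
    have h := ENNReal.rpow_le_rpow (hδ j) hq_pos.le
    rwa [eLpNorm_eq_lintegral_rpow_enorm_toReal hq₀ hq, ← ENNReal.rpow_mul,
      one_div_mul_cancel hq_pos.ne', ENNReal.rpow_one] at h
  have hmeas : ∀ j, AEMeasurable (fun ω => ‖W ω j‖ₑ ^ q.toReal) P := fun j =>
    (((PiLp.proj q (fun _ : ι => ℝ) j : _ →L[ℝ] ℝ).continuous.comp_aestronglyMeasurable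
      hW).enorm).pow_const _
  rw [eLpNorm_eq_lintegral_rpow_enorm_toReal hq₀ hq]
  simp_rw [hsum]
  rw [lintegral_finsetSum' _ fun j _ => hmeas j]
  calc (∑ j, ∫⁻ ω, ‖W ω j‖ₑ ^ q.toReal ∂P) ^ (1 / q.toReal)
      ≤ (∑ _j : ι, δ ^ q.toReal) ^ (1 / q.toReal) := by
        gcongr with j
        exact hcoord j
    _ = (Fintype.card ι : ℝ≥0∞) ^ (1 / q.toReal) * δ := by
        rw [Finset.sum_const, Finset.card_univ, nsmul_eq_mul,
          ENNReal.mul_rpow_of_nonneg _ _ (by positivity), ← ENNReal.rpow_mul,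
          mul_one_div_cancel hq_pos.ne', ENNReal.rpow_one]

/-- The Lipschitz concentration `Z ∝ 𝓔₂` of a single random vector, with explicit constants. -/
def ConcentratedWith {E : Type*} [NormedAddCommGroup E] (P : Measure Ω) (Z : Ω → E) (C c : ℝ) :
    Prop :=
  ∀ g : E → ℝ, LipschitzWith 1 g →
    Integrable (fun ω => g (Z ω)) P ∧
    ∀ t : ℝ, 0 < t →
      P.real {ω | t ≤ |g (Z ω) - ∫ ω', g (Z ω') ∂P|} ≤ C * Real.exp (-(t / c) ^ 2)

variable {E : Type*} [NormedAddCommGroup E] {Z : Ω → E}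

lemma ConcentratedWith.comp {F : Type*} [NormedAddCommGroup F] (h : ConcentratedWith P Z C c)
    {φ : E → F} (hφ : LipschitzWith 1 φ) : ConcentratedWith P (fun ω => φ (Z ω)) C c :=
  fun g hg => h (g ∘ φ) (by simpa using hg.comp hφ)

lemma ConcentratedWith.of_lipschitzWith (h : ConcentratedWith P Z C c) {g : E → ℝ} {K : ℝ≥0}
    (hK : 0 < K) (hg : LipschitzWith K g) :
    Integrable (fun ω => g (Z ω)) P ∧
    ∀ t : ℝ, 0 < t →
      P.real {ω | K * t ≤ |g (Z ω) - ∫ ω', g (Z ω') ∂P|} ≤ C * Real.exp (-(t / c) ^ 2) := by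
  have hK' : (0 : ℝ) < K := hK
  have hg' : LipschitzWith 1 fun v => (K : ℝ)⁻¹ * g v := by
    refine LipschitzWith.of_dist_le_mul fun u v => ?_
    rw [Real.dist_eq, ← mul_sub, abs_mul, abs_of_pos (inv_pos.2 hK'), ← Real.dist_eq,
      inv_mul_le_iff₀ hK', NNReal.coe_one, one_mul]
    exact hg.dist_le_mul u v
  obtain ⟨hint, htail⟩ := h _ hg'
  refine ⟨by simpa [← mul_assoc, hK'.ne'] using hint.const_mul (K : ℝ), fun t ht => ?_⟩
  convert htail t ht using 4 with ω
  rw [integral_const_mul, ← mul_sub, abs_mul, abs_of_pos (inv_pos.2 hK'), le_inv_mul_iff₀ hK']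

lemma ConcentratedWith.eLpNorm_sub_integral_le [IsFiniteMeasure P] (h : ConcentratedWith P Z C c)
    {q : ℝ≥0∞} (hq : q ≠ 0) (hq' : q ≠ ∞) {g : E → ℝ} (hg : LipschitzWith 1 g) :
    eLpNorm (fun ω => g (Z ω) - ∫ ω', g (Z ω') ∂P) q P ≤ tailMoment q.toReal C c :=
  eLpNorm_le_tailMoment hq hq' ((h g hg).1.aemeasurable.sub_const _) (h g hg).2

lemma ConcentratedWith.memLp [IsFiniteMeasure P] (h : ConcentratedWith P Z C c) (hC : 0 ≤ C)
    (hc : 0 < c) {q : ℝ≥0∞} (hq : q ≠ 0) (hq' : q ≠ ∞) {g : E → ℝ} (hg : LipschitzWith 1 g) :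
    MemLp (fun ω => g (Z ω)) q P := by
  have hcentered : MemLp (fun ω => g (Z ω) - ∫ ω', g (Z ω') ∂P) q P :=
    ⟨(h g hg).1.aestronglyMeasurable.sub aestronglyMeasurable_const,
      (h.eLpNorm_sub_integral_le hq hq' hg).trans_lt
        (tailMoment_ne_top (ENNReal.toReal_pos hq hq') hC hc).lt_top⟩
  simpa [Pi.add_def] using hcentered.add (memLp_const (∫ ω', g (Z ω') ∂P))

/-- A bound for the `L^q` norm of linear forms of norm one of a random vector satisfying
`ConcentratedWith P Z C c` and `‖𝔼 Z‖ ≤ m`. -/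
def linearMoment (q C c m : ℝ) : ℝ := (tailMoment q C c).toReal + m

variable [MeasurableSpace E] [BorelSpace E] [SecondCountableTopology E]

lemma ConcentratedWith.integrable (h : ConcentratedWith P Z C c) (hZ : Measurable Z) :
    Integrable Z P := by
  rw [← integrable_norm_iff hZ.aestronglyMeasurable]
  exact (h _ lipschitzWith_one_norm).1

variable [NormedSpace ℝ E] [CompleteSpace E] [IsProbabilityMeasure P]

lemma ConcentratedWith.eLpNorm_clm_le_linearMoment (h : ConcentratedWith P Z C c) (hC : 0 ≤ C)
    (hc : 0 < c) (hZ : Measurable Z) (hm : ‖∫ ω, Z ω ∂P‖ ≤ m) {q : ℝ≥0∞} (hq : 1 ≤ q)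
    (hq' : q ≠ ∞) {φ : E →L[ℝ] ℝ} (hφ : ‖φ‖ ≤ 1) :
    eLpNorm (fun ω => φ (Z ω)) q P ≤ ENNReal.ofReal (linearMoment q.toReal C c m) := by
  have hq₀ : q ≠ 0 := (zero_lt_one.trans_le hq).ne'
  have hm₀ : 0 ≤ m := (norm_nonneg _).trans hm
  have hmean : |∫ ω, φ (Z ω) ∂P| ≤ m := by
    rw [φ.integral_comp_comm (h.integrable hZ), ← Real.norm_eq_abs]
    exact (φ.le_of_opNorm_le hφ _).trans (by rwa [one_mul])
  have hlip : LipschitzWith 1 φ := φ.lipschitz.weaken (by exact_mod_cast hφ)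
  have hmeas : AEStronglyMeasurable (fun ω => φ (Z ω)) P := (h φ hlip).1.aestronglyMeasurable
  calc eLpNorm (fun ω => φ (Z ω)) q P
      = eLpNorm ((fun ω => φ (Z ω) - ∫ ω', φ (Z ω') ∂P) + fun _ => ∫ ω', φ (Z ω') ∂P) q P := by
        congr 1
        ext ω
        simp
    _ ≤ tailMoment q.toReal C c + ENNReal.ofReal m := by
        refine (eLpNorm_add_le (hmeas.sub aestronglyMeasurable_const)
          aestronglyMeasurable_const hq).trans (add_le_add
          (h.eLpNorm_sub_integral_le hq₀ hq' hlip) ?_)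
        rw [eLpNorm_const _ hq₀ (IsProbabilityMeasure.ne_zero P), measure_univ, ENNReal.one_rpow,
          mul_one, Real.enorm_eq_ofReal_abs]
        exact ENNReal.ofReal_le_ofReal hmean
    _ = ENNReal.ofReal (linearMoment q.toReal C c m) := by
        rw [linearMoment, ENNReal.ofReal_add ENNReal.toReal_nonneg hm₀,
          ENNReal.ofReal_toReal (tailMoment_ne_top (ENNReal.toReal_pos hq₀ hq') hC hc)]

lemma ConcentratedWith.eLpNorm_clm_le (h : ConcentratedWith P Z C c) (hC : 0 ≤ C) (hc : 0 < c)
    (hZ : Measurable Z) (hm : ‖∫ ω, Z ω ∂P‖ ≤ m) {q : ℝ≥0∞} (hq : 1 ≤ q) (hq' : q ≠ ∞)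
    (φ : E →L[ℝ] ℝ) :
    eLpNorm (fun ω => φ (Z ω)) q P ≤ ENNReal.ofReal (‖φ‖ * linearMoment q.toReal C c m) := by
  rcases eq_or_ne φ 0 with rfl | hφ
  · simp
  have hscale : (fun ω => φ (Z ω)) = ‖φ‖ • fun ω => (‖φ‖⁻¹ • φ) (Z ω) := by
    ext ω
    simp [hφ]
  have hunit : ‖‖φ‖⁻¹ • φ‖ ≤ 1 := by
    rw [norm_smul, norm_inv, norm_norm, inv_mul_cancel₀ (norm_ne_zero_iff.2 hφ)]
  rw [hscale, eLpNorm_const_smul, enorm_norm, ENNReal.ofReal_mul (norm_nonneg φ), ofReal_norm]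
  gcongr
  exact h.eLpNorm_clm_le_linearMoment hC hc hZ hm hq hq' hunit

lemma ConcentratedWith.integral_norm_clm_piLp_le (h : ConcentratedWith P Z C c) (hC : 0 ≤ C)
    (hc : 0 < c) (hZ : Measurable Z) (hm : ‖∫ ω, Z ω ∂P‖ ≤ m) {ι : Type*} [Fintype ι] {q : ℝ≥0∞}
    [Fact (1 ≤ q)] (hq : q ≠ ∞) (T : E →L[ℝ] PiLp q fun _ : ι => ℝ) :
    ∫ ω, ‖T (Z ω)‖ ∂P
      ≤ (Fintype.card ι : ℝ) ^ (1 / q.toReal) * (‖T‖ * linearMoment q.toReal C c m) := by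
  have hm₀ : 0 ≤ m := (norm_nonneg _).trans hm
  have hM : 0 ≤ linearMoment q.toReal C c m := add_nonneg ENNReal.toReal_nonneg hm₀
  have hTZ : AEStronglyMeasurable (fun ω => T (Z ω)) P :=
    T.continuous.comp_aestronglyMeasurable hZ.aestronglyMeasurable
  have hcoord : ∀ j, eLpNorm (fun ω => T (Z ω) j) q P
      ≤ ENNReal.ofReal (‖T‖ * linearMoment q.toReal C c m) := fun j => by
    let φ : E →L[ℝ] ℝ := (PiLp.proj q (fun _ : ι => ℝ) j : _ →L[ℝ] ℝ) ∘L T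
    have hnorm : ‖φ‖ ≤ ‖T‖ :=
      ContinuousLinearMap.opNorm_le_bound _ (norm_nonneg _) fun v =>
        (PiLp.norm_apply_le (T v) j).trans (T.le_opNorm v)
    exact (h.eLpNorm_clm_le hC hc hZ hm Fact.out hq φ).trans
      (ENNReal.ofReal_le_ofReal (mul_le_mul_of_nonneg_right hnorm hM))
  rw [← ENNReal.ofReal_le_ofReal_iff (by positivity),
    ofReal_integral_norm_eq_lintegral_enorm (T.integrable_comp (h.integrable hZ)),
    ← eLpNorm_one_eq_lintegral_enorm, ENNReal.ofReal_mul (by positivity),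
    ← ENNReal.ofReal_rpow_of_nonneg (by positivity) (by positivity), ENNReal.ofReal_natCast]
  exact (eLpNorm_le_eLpNorm_of_exponent_le Fact.out hTZ).trans
    (eLpNorm_piLp_le_of_forall hq hTZ hcoord)

lemma ConcentratedWith.measureReal_norm_clm_piLp_le (h : ConcentratedWith P Z C c) (hC : 0 ≤ C)
    (hc : 0 < c) (hZ : Measurable Z) (hm : ‖∫ ω, Z ω ∂P‖ ≤ m) {ι : Type*} [Fintype ι] {q : ℝ≥0∞}
    [Fact (1 ≤ q)] (hq : q ≠ ∞) {T : E →L[ℝ] PiLp q fun _ : ι => ℝ} {K : ℝ} (hK : 0 < K)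
    (hT : ‖T‖ ≤ K) {t : ℝ} (ht : 0 < t) :
    P.real {ω | K * (linearMoment q.toReal C c m * (Fintype.card ι : ℝ) ^ (1 / q.toReal) + t)
      ≤ ‖T (Z ω)‖} ≤ C * Real.exp (-(t / c) ^ 2) := by
  lift K to ℝ≥0 using hK.le
  have hlip : LipschitzWith K fun v => ‖T v‖ := by
    simpa [Function.comp_def] using
      lipschitzWith_one_norm.comp (T.lipschitz.weaken (by exact_mod_cast hT))
  refine (measureReal_mono fun ω hω => ?_).trans
    ((h.of_lipschitzWith (by exact_mod_cast hK) hlip).2 t ht)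
  have hM : 0 ≤ linearMoment q.toReal C c m :=
    add_nonneg ENNReal.toReal_nonneg ((norm_nonneg _).trans hm)
  have hmean : ∫ ω, ‖T (Z ω)‖ ∂P
      ≤ K * (linearMoment q.toReal C c m * (Fintype.card ι : ℝ) ^ (1 / q.toReal)) := by
    refine (h.integral_norm_clm_piLp_le hC hc hZ hm hq T).trans ?_
    rw [mul_left_comm, mul_comm (linearMoment _ _ _ _)]
    gcongr
  rw [Set.mem_ofPred_eq, mul_add] at hω
  exact (le_sub_iff_add_le'.2 ((add_le_add_left hmean _).trans hω)).trans (le_abs_self _)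

end Moments

section Conditioning

variable {Ω : Type*} [MeasurableSpace Ω] {P : Measure Ω} {A : Set Ω} {δ : ℝ}

lemma measure_ne_zero_of_le_measureReal (hδ : 0 < δ) (hδA : δ ≤ P.real A) : P A ≠ 0 := fun h =>
  (hδ.trans_le hδA).ne' (by rw [measureReal_def, h, ENNReal.toReal_zero])

lemma cond_real_le {B : Set Ω} (hA : MeasurableSet A) (hδ : 0 < δ) (hδA : δ ≤ P.real A) :
    (P[|A]).real B ≤ δ⁻¹ * P.real (A ∩ B) := by
  rw [measureReal_def, cond_apply hA, ENNReal.toReal_mul, ENNReal.toReal_inv]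
  exact mul_le_mul_of_nonneg_right (inv_anti₀ hδ hδA) ENNReal.toReal_nonneg

lemma lintegral_cond_le [IsFiniteMeasure P] (hA : MeasurableSet A) (hδ : 0 < δ)
    (hδA : δ ≤ P.real A) {F G : Ω → ℝ≥0∞} (hFG : ∀ ω ∈ A, F ω ≤ G ω) :
    ∫⁻ ω, F ω ∂(P[|A]) ≤ ENNReal.ofReal δ⁻¹ * ∫⁻ ω, G ω ∂P := by
  have hPA : (P A)⁻¹ ≤ ENNReal.ofReal δ⁻¹ := by
    rw [ENNReal.ofReal_inv_of_pos hδ, ENNReal.inv_le_inv, ← ofReal_measureReal]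
    exact ENNReal.ofReal_le_ofReal hδA
  rw [ProbabilityTheory.cond, lintegral_smul_measure, smul_eq_mul]
  exact mul_le_mul' hPA ((setLIntegral_mono' hA hFG).trans (setLIntegral_le_lintegral _ _))

lemma aemeasurable_comp_cond {α β : Type*} [MeasurableSpace α] [MeasurableSpace β] {X : Ω → α}
    (hX : Measurable X) {s : Set α} (hs : MeasurableSet s) {F : α → β}
    (hF : Measurable fun a : s => F a) :
    AEMeasurable (fun ω => F (X ω)) (P[|X ⁻¹' s]) := by
  have hF' : AEMeasurable F ((P.map X).restrict s) :=
    aemeasurable_restrict_of_measurable_subtype hs hF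
  rw [Measure.restrict_map hX hs] at hF'
  exact (hF'.comp_measurable hX).smul_measure _

end Conditioning

section Freezing

variable {Ω α β : Type*} [MeasurableSpace Ω] [MeasurableSpace α] [MeasurableSpace β]
  {P : Measure Ω} {ξ : Ω → α} {Z : Ω → β}

lemma lintegral_le_of_indepFun [IsProbabilityMeasure P] (hξ : Measurable ξ) (hZ : Measurable Z)
    (hindep : IndepFun ξ Z P) {F : α × β → ℝ≥0∞} (hF : Measurable F) {δ : ℝ≥0∞}
    (hδ : ∀ a, ∫⁻ ω, F (a, Z ω) ∂P ≤ δ) : ∫⁻ ω, F (ξ ω, Z ω) ∂P ≤ δ := by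
  have := Measure.isProbabilityMeasure_map hξ.aemeasurable (μ := P)
  have := Measure.isProbabilityMeasure_map hZ.aemeasurable (μ := P)
  rw [← lintegral_map (f := F) hF (hξ.prodMk hZ),
    (indepFun_iff_map_prod_eq_prod_map_map hξ.aemeasurable hZ.aemeasurable).1 hindep,
    lintegral_prod _ hF.aemeasurable]
  calc ∫⁻ a, ∫⁻ b, F (a, b) ∂(P.map Z) ∂(P.map ξ) ≤ ∫⁻ _, δ ∂(P.map ξ) := by
        refine lintegral_mono fun a => ?_
        rw [lintegral_map (f := fun b => F (a, b)) (hF.comp measurable_prodMk_left) hZ]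
        exact hδ a
    _ = δ := by simp

lemma measure_le_of_indepFun [IsProbabilityMeasure P] (hξ : Measurable ξ) (hZ : Measurable Z)
    (hindep : IndepFun ξ Z P) {T : Set (α × β)} (hT : MeasurableSet T) {δ : ℝ≥0∞}
    (hδ : ∀ a, P {ω | (a, Z ω) ∈ T} ≤ δ) : P {ω | (ξ ω, Z ω) ∈ T} ≤ δ := by
  have hind : ∀ η : Ω → α, Measurable η →
      ∫⁻ ω, T.indicator 1 (η ω, Z ω) ∂P = P {ω | (η ω, Z ω) ∈ T} := fun η hη =>
    lintegral_indicator_one (μ := P) ((hη.prodMk hZ) hT)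
  rw [← hind ξ hξ]
  refine lintegral_le_of_indepFun hξ hZ hindep (measurable_one.indicator hT) fun a => ?_
  rw [hind _ measurable_const]
  exact hδ a

variable {ι E : Type*} [DecidableEq ι] [Zero E] [MeasurableSpace E] {x : ι → Ω → E}

lemma measurable_update_zero (hx : ∀ j, Measurable (x j)) (i : ι) :
    Measurable fun ω => Function.update (fun j => x j ω) i 0 :=
  (measurable_update' (a := i)).comp ((measurable_pi_lambda _ hx).prodMk measurable_const)

lemma indepFun_update_zero [Finite ι] (hindep : iIndepFun x P) (hx : ∀ j, Measurable (x j))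
    (i : ι) : IndepFun (fun ω => Function.update (fun j => x j ω) i 0) (x i) P := by
  have := Fintype.ofFinite ι
  have hblocks := hindep.indepFun_finset (Finset.univ.erase i) {i}
    (Finset.disjoint_singleton_right.2 (Finset.notMem_erase i _)) hx
  have hextend : Measurable fun (v : ↥(Finset.univ.erase i) → E) (j : ι) =>
      if hj : j ∈ Finset.univ.erase i then v ⟨j, hj⟩ else 0 := by
    refine measurable_pi_lambda _ fun j => ?_
    split_ifs
    · exact measurable_pi_apply _
    · exact measurable_const
  have heval : Measurable fun v : ↥({i} : Finset ι) → E => v ⟨i, Finset.mem_singleton_self i⟩ :=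
    measurable_pi_apply _
  convert hblocks.comp hextend heval using 1
  · ext ω j
    by_cases hj : j = i
    · subst hj; simp
    · simp [hj]
  · rfl

end Freezing

section GoodEvent

variable {Ω : Type*} {n p : ℕ} {x : Fin n → Ω → EuclideanSpace ℝ (Fin p)} {C c lam ε : ℝ}

lemma lt_of_notMem_goodEvent {ω : Ω} (hω : ω ∉ goodEvent x lam ε) :
    1 - ε < lam / n * gramNorm fun j => x j ω := by
  simpa only [goodEvent, Set.mem_ofPred_eq, not_le] using hω

variable [MeasurableSpace Ω] {P : Measure Ω} [IsProbabilityMeasure P]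

lemma measurableSet_goodEvent (hx : ∀ j, Measurable (x j)) (lam ε : ℝ) :
    MeasurableSet (goodEvent x lam ε) :=
  measurable_pi_lambda _ hx (isClosed_goodData lam ε).measurableSet

lemma memLp_sqrt_gramNorm (hC : 0 ≤ C) (hc : 0 < c)
    (hX : ConcentratedWith P (fun ω => WithLp.toLp 2 fun j => x j ω) C c) :
    MemLp (fun ω => √(gramNorm fun j => x j ω)) 2 P :=
  hX.memLp hC hc two_ne_zero ENNReal.ofNat_ne_top lipschitzWith_sqrt_gramNorm

lemma integrable_gramNorm (hC : 0 ≤ C) (hc : 0 < c)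
    (hX : ConcentratedWith P (fun ω => WithLp.toLp 2 fun j => x j ω) C c) :
    Integrable (fun ω => gramNorm fun j => x j ω) P := by
  simpa only [Real.sq_sqrt (gramNorm_nonneg _)] using (memLp_sqrt_gramNorm hC hc hX).integrable_sq

lemma sq_integral_sqrt_gramNorm_le (hC : 0 ≤ C) (hc : 0 < c)
    (hX : ConcentratedWith P (fun ω => WithLp.toLp 2 fun j => x j ω) C c) :
    (∫ ω, √(gramNorm fun j => x j ω) ∂P) ^ 2 ≤ ∫ ω, gramNorm (fun j => x j ω) ∂P := by
  have hvar := variance_eq_sub (memLp_sqrt_gramNorm hC hc hX)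
  simp only [Pi.pow_apply, Real.sq_sqrt (gramNorm_nonneg _)] at hvar
  linarith [variance_nonneg (fun ω => √(gramNorm fun j => x j ω)) P]

lemma le_measureReal_goodEvent (hx : ∀ j, Measurable (x j)) (hlam : 0 ≤ lam) (hε : 0 < ε)
    (hint : Integrable (fun ω => gramNorm fun j => x j ω) P)
    (hcontr : 2 * ε ≤ 1 - lam / n * ∫ ω, gramNorm (fun j => x j ω) ∂P) :
    ε ≤ P.real (goodEvent x lam ε) := by
  have hmean_nonneg : 0 ≤ lam / n * ∫ ω, gramNorm (fun j => x j ω) ∂P :=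
    mul_nonneg (by positivity) (integral_nonneg fun ω => gramNorm_nonneg _)
  have hmarkov := mul_meas_ge_le_integral_of_nonneg (μ := P)
    (f := fun ω => lam / n * gramNorm fun j => x j ω)
    (.of_forall fun ω => mul_nonneg (by positivity) (gramNorm_nonneg _))
    (hint.const_mul _) (1 - ε)
  rw [integral_const_mul] at hmarkov
  have hsub : (goodEvent x lam ε)ᶜ ⊆ {ω | 1 - ε ≤ lam / n * gramNorm fun j => x j ω} :=
    fun ω hω => (lt_of_notMem_goodEvent hω).le
  have hcompl : (1 - ε) * (1 - P.real (goodEvent x lam ε)) ≤ 1 - 2 * ε := by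
    rw [← probReal_compl_eq_one_sub (measurableSet_goodEvent hx lam ε)]
    exact (mul_le_mul_of_nonneg_left (measureReal_mono hsub) (by linarith)).trans
      (hmarkov.trans (by linarith))
  by_contra! hlt
  nlinarith

lemma half_le_sqrt_sub_sqrt (hε : 0 ≤ ε) (hε' : 0 ≤ 1 - 2 * ε) :
    ε / 2 ≤ √(1 - ε) - √(1 - 2 * ε) := by
  have hsq := Real.sq_sqrt (show 0 ≤ 1 - ε by linarith)
  have hsq' := Real.sq_sqrt hε'
  have hle : √(1 - ε) ≤ 1 := Real.sqrt_le_one.2 (by linarith)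
  have hle' : √(1 - 2 * ε) ≤ √(1 - ε) := Real.sqrt_le_sqrt (by linarith)
  nlinarith

lemma integral_sqrt_gramNorm_le (hn : 0 < n) (hlam : 0 < lam) (hC : 0 ≤ C) (hc : 0 < c)
    (hX : ConcentratedWith P (fun ω => WithLp.toLp 2 fun j => x j ω) C c)
    (hcontr : 2 * ε ≤ 1 - lam / n * ∫ ω, gramNorm (fun j => x j ω) ∂P) :
    ∫ ω, √(gramNorm fun j => x j ω) ∂P ≤ √(n / lam) * √(1 - 2 * ε) := by
  rw [← Real.sqrt_mul (by positivity)]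
  refine Real.le_sqrt_of_sq_le ((sq_integral_sqrt_gramNorm_le hC hc hX).trans ?_)
  rw [← div_le_iff₀' (by positivity), div_div_eq_mul_div, mul_div_assoc, mul_comm]
  linarith

lemma measureReal_goodEvent_compl_le (hlam : 0 < lam) (hε : 0 < ε) (hC : 0 ≤ C)
    (hc : 0 < c) (hX : ConcentratedWith P (fun ω => WithLp.toLp 2 fun j => x j ω) C c)
    (hcontr : 2 * ε ≤ 1 - lam / n * ∫ ω, gramNorm (fun j => x j ω) ∂P) :
    P.real (goodEvent x lam ε)ᶜ ≤ C * Real.exp (-((ε / 2) ^ 2 / (lam * c ^ 2) * n)) := by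
  have hε' : 0 ≤ 1 - 2 * ε := by
    have : 0 ≤ lam / n * ∫ ω, gramNorm (fun j => x j ω) ∂P :=
      mul_nonneg (by positivity) (integral_nonneg fun ω => gramNorm_nonneg _)
    linarith
  rcases n.eq_zero_or_pos with rfl | hn
  · have huniv : goodEvent x lam ε = Set.univ := Set.eq_univ_of_forall fun ω => by
      rw [goodEvent, Set.mem_ofPred_eq, Nat.cast_zero, div_zero, zero_mul]
      linarith
    simpa [huniv] using hC
  have hmean := integral_sqrt_gramNorm_le hn hlam hC hc hX hcontr
  refine (measureReal_mono fun ω hω => ?_).trans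
    (((hX _ lipschitzWith_sqrt_gramNorm).2 (√(n / lam) * (ε / 2)) (by positivity)).trans_eq ?_)
  · have hbad : √(n / lam) * √(1 - ε) ≤ √(gramNorm fun j => x j ω) := by
      rw [← Real.sqrt_mul (by positivity)]
      refine Real.sqrt_le_sqrt ?_
      rw [← le_div_iff₀' (by positivity), div_div_eq_mul_div, mul_div_assoc, mul_comm]
      exact (lt_of_notMem_goodEvent hω).le
    rw [Set.mem_ofPred_eq]
    refine le_trans ?_ (le_abs_self _)
    calc √(n / lam) * (ε / 2) ≤ √(n / lam) * (√(1 - ε) - √(1 - 2 * ε)) := by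
          gcongr
          exact half_le_sqrt_sub_sqrt hε.le hε'
      _ ≤ _ := by
          rw [mul_sub]
          exact sub_le_sub hbad hmean
  · congr 3
    rw [div_pow, mul_pow, Real.sq_sqrt (by positivity)]
    field_simp

end GoodEvent

section Columns

variable {Ω : Type*} [MeasurableSpace Ω] {P : Measure Ω} {C c : ℝ}

lemma ConcentratedWith.column {n p : ℕ} {x : Fin n → Ω → EuclideanSpace ℝ (Fin p)}
    (hX : ConcentratedWith P (fun ω => WithLp.toLp 2 fun j => x j ω) C c) (i : Fin n) :
    ConcentratedWith P (x i) C c :=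
  hX.comp (φ := fun X : PiLp 2 fun _ : Fin n => EuclideanSpace ℝ (Fin p) => X i)
    (LipschitzWith.of_dist_le_mul fun X Y => by
      rw [NNReal.coe_one, one_mul, dist_eq_norm, dist_eq_norm, ← PiLp.sub_apply]
      exact PiLp.norm_apply_le _ i)

lemma LipschitzConcentrated.exists_concentratedWith {S : Type*} {Ω : S → Type*}
    [∀ s, MeasurableSpace (Ω s)] {P : ∀ s, Measure (Ω s)} {E : S → Type*}
    [∀ s, NormedAddCommGroup (E s)] {Z : ∀ s, Ω s → E s}
    (h : LipschitzConcentrated P Z 2 fun _ => 1) :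
    ∃ C > 0, ∃ c > 0, ∀ s, ConcentratedWith (P s) (Z s) C c := by
  obtain ⟨C, hC, c, hc, h⟩ := h
  refine ⟨C, hC, c, hc, fun s g hg => ⟨(h s g hg).1, fun t ht => ?_⟩⟩
  simpa only [mul_one, Real.rpow_two] using (h s g hg).2 t ht

end Columns

section SupBridge

variable {n p : ℕ} {f : ℝ → ℝ} {lam : ℝ≥0} {ε : ℝ}

lemma abs_inner_bridge_le {x : Fin n → EuclideanSpace ℝ (Fin p)} (hlip : LipschitzWith lam f)
    (hlam : 0 < lam) (hε : 0 < ε) (hx : x ∈ goodData n p lam ε) (i : Fin n) {t : ℝ}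
    (ht : t ∈ Set.Icc (0 : ℝ) 1) :
    |inner ℝ (x i) (bridge f x i t)|
      ≤ (1 + ε⁻¹) * |inner ℝ (x i) (leaveOneOut f x i)| + |f 0| / (lam * ε) := by
  have hn : (0 : ℝ) < n := by exact_mod_cast i.pos
  set z := leaveOneOut f x i
  have hfz : |f (inner ℝ (x i) z)| ≤ |f 0| + lam * |inner ℝ (x i) z| := by
    have h := hlip.dist_le_mul (inner ℝ (x i) z) 0
    rw [Real.dist_eq, Real.dist_eq, sub_zero] at h
    linarith [abs_sub_abs_le_abs_sub (f (inner ℝ (x i) z)) (f 0)]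
  have hcol : ‖x i‖ ^ 2 ≤ n / lam :=
    (Real.le_sqrt (norm_nonneg _) (by positivity)).1 (norm_column_le_of_mem_goodData hlam hε hx i)
  have hstep : ‖bridge f x i t - z‖ ≤ ε⁻¹ * (t / n * (|f (inner ℝ (x i) z)| * ‖x i‖)) := by
    have h := norm_bridge_sub_bridge_le hlip hε hx i (s := 0) ⟨le_rfl, zero_le_one⟩ ht
    rwa [← leaveOneOut_eq_bridge_zero, sub_zero, abs_of_nonneg ht.1] at h
  have hmove : |inner ℝ (x i) (bridge f x i t - z)|
      ≤ ε⁻¹ * |inner ℝ (x i) z| + |f 0| / (lam * ε) :=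
    calc _ ≤ ‖x i‖ * (ε⁻¹ * (t / n * (|f (inner ℝ (x i) z)| * ‖x i‖))) :=
          (abs_real_inner_le_norm _ _).trans (by gcongr)
      _ = ε⁻¹ * (t * (‖x i‖ ^ 2 / n) * |f (inner ℝ (x i) z)|) := by ring
      _ ≤ ε⁻¹ * (1 * (n / lam / n) * (|f 0| + lam * |inner ℝ (x i) z|)) := by
          have := ht.1
          gcongr
          exact ht.2
      _ = _ := by field_simp; ring
  have htri := abs_add_le (inner ℝ (x i) z) (inner ℝ (x i) (bridge f x i t - z))
  rw [← inner_add_right, add_sub_cancel] at htri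
  linarith

lemma supBridge_le {x : Fin n → EuclideanSpace ℝ (Fin p)} (hlip : LipschitzWith lam f)
    (hlam : 0 < lam) (hε : 0 < ε) (hx : x ∈ goodData n p lam ε) (i : Fin n) :
    supBridge f x i ≤ ENNReal.ofReal (1 + ε⁻¹) *
      ENNReal.ofReal |inner ℝ (x i) (leaveOneOut f x i)| + ENNReal.ofReal (|f 0| / (lam * ε)) := by
  refine iSup_le fun t => ?_
  rw [← ENNReal.ofReal_mul (by positivity), ← ENNReal.ofReal_add (by positivity) (by positivity)]
  exact ENNReal.ofReal_le_ofReal (abs_inner_bridge_le hlip hlam hε hx i t.2)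

lemma measurable_supBridge_goodData (hlip : LipschitzWith lam f) (hε : 0 < ε) (i : Fin n) :
    Measurable fun x : goodData n p lam ε => supBridge f x.1 i := by
  refine (lowerSemicontinuous_iSup fun t => Continuous.lowerSemicontinuous ?_).measurable
  have hbridge := (continuousOn_bridge_left (p := p) hlip hε i t.2).domRestrict
  have hcol : Continuous fun x : goodData n p lam ε => x.1 i :=
    (continuous_apply i).comp continuous_subtype_val
  exact ENNReal.continuous_ofReal.comp (hcol.inner hbridge).abs

variable {Ω : Type*} [MeasurableSpace Ω] {P : Measure Ω}
  {x : Fin n → Ω → EuclideanSpace ℝ (Fin p)} {C c m : ℝ}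

lemma aemeasurable_supBridge_cond (hlip : LipschitzWith lam f) (hε : 0 < ε)
    (hx : ∀ j, Measurable (x j)) (i : Fin n) :
    AEMeasurable (fun ω => supBridge f (fun j => x j ω) i) (P[|goodEvent x lam ε]) :=
  aemeasurable_comp_cond (F := fun a => supBridge f a i) (measurable_pi_lambda _ hx)
    (isClosed_goodData lam ε).measurableSet (measurable_supBridge_goodData hlip hε i)

variable [IsProbabilityMeasure P]

lemma lintegral_inner_indicator_leaveOneOut_le (hlip : LipschitzWith lam f) (hlam : 0 < lam)
    (hε : 0 < ε) (hC : 0 ≤ C) (hc : 0 < c) (hx : ∀ j, Measurable (x j)) (hindep : iIndepFun x P)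
    (i : Fin n) (hi : ConcentratedWith P (x i) C c) (hm : ‖∫ ω, x i ω ∂P‖ ≤ m) :
    ∫⁻ ω, ENNReal.ofReal |inner ℝ (x i ω) ((goodData n p lam ε).indicator
        (fun a => leaveOneOut f a i) (Function.update (fun j => x j ω) i 0))| ∂P
      ≤ ENNReal.ofReal (ε⁻¹ * (|f 0| * √(lam : ℝ)⁻¹) * linearMoment 1 C c m) := by
  set Y := (goodData n p lam ε).indicator fun a => leaveOneOut f a i
  have hY : Measurable Y := by
    classical
    simp only [Y, ← Set.piecewise_eq_indicator]
    exact (continuousOn_leaveOneOut hlip hε i).measurable_piecewise continuousOn_const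
      (isClosed_goodData lam ε).measurableSet
  have hYnorm : ∀ a, ‖Y a‖ ≤ ε⁻¹ * (|f 0| * √(lam : ℝ)⁻¹) := fun a => by
    by_cases ha : a ∈ goodData n p lam ε
    · simpa only [Y, Set.indicator_of_mem ha] using norm_leaveOneOut_le hlip hlam hε ha i
    · simpa only [Y, Set.indicator_of_notMem ha, norm_zero] using (by positivity)
  refine lintegral_le_of_indepFun (F := fun q => ENNReal.ofReal |inner ℝ q.2 (Y q.1)|)
    (measurable_update_zero hx i) (hx i) (indepFun_update_zero hindep hx i)
    (measurable_snd.inner (hY.comp measurable_fst)).abs.ennreal_ofReal fun a => ?_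
  have h := hi.eLpNorm_clm_le hC hc (hx i) hm le_rfl ENNReal.one_ne_top (innerSL ℝ (Y a))
  rw [eLpNorm_one_eq_lintegral_enorm, innerSL_apply_norm, ENNReal.toReal_one] at h
  simp only [innerSL_apply_apply, real_inner_comm, Real.enorm_eq_ofReal_abs] at h
  refine h.trans (ENNReal.ofReal_le_ofReal (mul_le_mul_of_nonneg_right (hYnorm a) ?_))
  exact add_nonneg ENNReal.toReal_nonneg ((norm_nonneg _).trans hm)

lemma lintegral_supBridge_cond_le (hlip : LipschitzWith lam f) (hlam : 0 < lam) (hε : 0 < ε)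
    (hC : 0 ≤ C) (hc : 0 < c) (hx : ∀ j, Measurable (x j)) (hindep : iIndepFun x P)
    (hA : ε ≤ P.real (goodEvent x lam ε)) {i : Fin n} (hi : ConcentratedWith P (x i) C c)
    (hm : ‖∫ ω, x i ω ∂P‖ ≤ m) :
    ∫⁻ ω, supBridge f (fun j => x j ω) i ∂(P[|goodEvent x lam ε])
      ≤ ENNReal.ofReal ε⁻¹ * (ENNReal.ofReal (1 + ε⁻¹)
          * ENNReal.ofReal (ε⁻¹ * (|f 0| * √(lam : ℝ)⁻¹) * linearMoment 1 C c m)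
        + ENNReal.ofReal (|f 0| / (lam * ε))) := by
  refine (lintegral_cond_le (measurableSet_goodEvent hx lam ε) hε hA fun ω hω => ?_).trans
    (mul_le_mul_right (b := ∫⁻ ω, (ENNReal.ofReal (1 + ε⁻¹) * ENNReal.ofReal |inner ℝ (x i ω)
      ((goodData n p lam ε).indicator (fun a => leaveOneOut f a i)
        (Function.update (fun j => x j ω) i 0))| + ENNReal.ofReal (|f 0| / (lam * ε))) ∂P) ?_ _)
  · have hω' : (fun j => x j ω) ∈ goodData n p lam ε := hω
    rw [Set.indicator_of_mem (update_zero_mem_goodData hω' i), leaveOneOut_update]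
    exact supBridge_le hlip hlam hε hω' i
  · rw [lintegral_add_right _ measurable_const, lintegral_const, measure_univ, mul_one,
      lintegral_const_mul' _ _ ENNReal.ofReal_ne_top]
    gcongr
    exact lintegral_inner_indicator_leaveOneOut_le hlip hlam hε hC hc hx hindep i hi hm

end SupBridge

section Residual

lemma measureReal_le_of_affine_tail {Ω : Type*} [MeasurableSpace Ω] {μ : Measure Ω}
    [IsProbabilityMeasure μ] {W : Ω → ℝ} {C c θ v : ℝ} (hC : 0 ≤ C) (hc : 0 < c) (hθ : 0 ≤ θ)
    (hv : 0 < v)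
    (htail : ∀ t : ℝ, 0 < t → μ.real {ω | θ + v * t < W ω} ≤ C * Real.exp (-(t / c) ^ 2))
    {s : ℝ} (hs : 0 < s) :
    μ.real {ω | s ≤ W ω} ≤ (C + Real.exp 1) * Real.exp (-(s / (4 * v * c + 2 * θ)) ^ 2) := by
  rcases le_or_gt (2 * θ) s with hlarge | hsmall
  · have hsub : {ω | s ≤ W ω} ⊆ {ω | θ + v * (s / (4 * v)) < W ω} := fun ω hω => by
      have hquarter : v * (s / (4 * v)) = s / 4 := by field_simp
      rw [Set.mem_ofPred_eq] at hω ⊢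
      linarith
    calc μ.real {ω | s ≤ W ω} ≤ C * Real.exp (-(s / (4 * v) / c) ^ 2) :=
          (measureReal_mono hsub).trans (htail _ (by positivity))
      _ ≤ (C + Real.exp 1) * Real.exp (-(s / (4 * v * c + 2 * θ)) ^ 2) := by
          rw [div_div]
          gcongr
          · exact le_add_of_nonneg_right (Real.exp_pos 1).le
          · exact le_add_of_nonneg_right (by positivity)
  · have hratio : s / (4 * v * c + 2 * θ) ≤ 1 :=
      (div_le_one (by positivity)).2 (hsmall.le.trans (le_add_of_nonneg_left (by positivity)))
    calc μ.real {ω | s ≤ W ω} ≤ Real.exp 1 * Real.exp (-1) := by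
          rw [← Real.exp_add, add_neg_cancel, Real.exp_zero]
          exact measureReal_le_one
      _ ≤ (C + Real.exp 1) * Real.exp (-(s / (4 * v * c + 2 * θ)) ^ 2) := by
          gcongr
          · exact le_add_of_nonneg_left hC
          · exact pow_le_one₀ (by positivity) hratio

variable {n p : ℕ} {f : ℝ → ℝ} {lam L : ℝ≥0} {ε B M : ℝ}

/-- The constant term of the bound `n ‖Y - Y₋ᵢ - (1/n) f(xᵢᵀ Y) Q₋ᵢ xᵢ‖ ≤ θ + v t`, which holds
where the `ℓ⁴` norm of `(xⱼᵀ Q₋ᵢ xᵢ)_{j ≠ i}` is at most `(√(n/lam) / ε) (M n^{1/4} + t)`. -/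
def residualOffset (lam ε L B M : ℝ) : ℝ := 2 * expansionConst lam ε L B * M ^ 2 * √lam

/-- The coefficient of `t` in the bound `n ‖Y - Y₋ᵢ - (1/n) f(xᵢᵀ Y) Q₋ᵢ xᵢ‖ ≤ θ + v t` of
`residualOffset`. -/
def residualSlope (lam ε L B : ℝ) : ℝ := 2 * expansionConst lam ε L B + 2 * B / ε

lemma residualOffset_nonneg (hε : 0 ≤ ε) (hB : 0 ≤ B) : 0 ≤ residualOffset lam ε L B M := by
  have := expansionConst_nonneg (lam := lam) (L := L) hε hB
  unfold residualOffset
  positivity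

lemma residualSlope_pos (hε : 0 < ε) (hB : 0 < B) : 0 < residualSlope lam ε L B :=
  add_pos_of_nonneg_of_pos
    (mul_nonneg zero_le_two (expansionConst_nonneg hε.le hB.le)) (by positivity)

lemma natCast_mul_residualNorm_le_affine {x : Fin n → EuclideanSpace ℝ (Fin p)}
    (hf : Differentiable ℝ f) (hlip : LipschitzWith lam f) (hL : LipschitzWith L (deriv f))
    (hlam : 0 < lam) (hε : 0 < ε) (hB : ∀ u, |f u| ≤ B) (hx : x ∈ goodData n p lam ε) {i : Fin n}
    {t : ℝ} (ht : 0 ≤ t)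
    (hcross : ‖crossForms f x i (x i)‖ ≤ √(n / lam) / ε * (M * (n : ℝ) ^ (1 / 4 : ℝ) + t)) :
    n * residualNorm f x i ≤ residualOffset lam ε L B M + residualSlope lam ε L B * t := by
  have hB₀ : 0 ≤ B := (abs_nonneg _).trans (hB 0)
  have hn : (0 : ℝ) < n := by exact_mod_cast i.pos
  have hlam' : (0 : ℝ) < lam := hlam
  have hD : 0 ≤ expansionConst lam ε L B := expansionConst_nonneg hε.le hB₀
  have hθ : 0 ≤ residualOffset lam ε L B M := residualOffset_nonneg hε.le hB₀
  rw [residualSlope, add_mul]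
  set g := √(n / lam : ℝ)
  have hg : 0 < g := by positivity
  rcases le_or_gt t g with htg | htg
  · have hroot : ((n : ℝ) ^ (1 / 4 : ℝ)) ^ 2 = √lam * g := by
      rw [← Real.sqrt_mul hlam'.le, mul_div_cancel₀ _ hlam'.ne', Real.sqrt_eq_rpow,
        ← Real.rpow_natCast, ← Real.rpow_mul hn.le]
      norm_num
    calc n * residualNorm f x i
        ≤ expansionConst lam ε L B * (M * (n : ℝ) ^ (1 / 4 : ℝ) + t) ^ 2 / g :=
          natCast_mul_residualNorm_le_sq hf hlip hL hlam hε hB hx hcross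
      _ ≤ expansionConst lam ε L B * (2 * ((M * (n : ℝ) ^ (1 / 4 : ℝ)) ^ 2 + t ^ 2)) / g := by
          gcongr
          exact add_sq_le
      _ = residualOffset lam ε L B M + 2 * expansionConst lam ε L B * t * (t / g) := by
          rw [mul_pow, hroot, residualOffset]
          field_simp
      _ ≤ residualOffset lam ε L B M + 2 * expansionConst lam ε L B * t * 1 := by
          gcongr
          exact (div_le_one hg).2 htg
      _ ≤ _ := by
          have : 0 ≤ 2 * B / ε * t := by positivity
          linarith
  · calc n * residualNorm f x i ≤ 2 * B / ε * g := natCast_mul_residualNorm_le hlip hlam hε hB hx i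
      _ ≤ 2 * B / ε * t := by gcongr
      _ ≤ _ := by
          have : 0 ≤ 2 * expansionConst lam ε L B * t := by positivity
          linarith

variable {Ω : Type*} [MeasurableSpace Ω] {P : Measure Ω}
  {x : Fin n → Ω → EuclideanSpace ℝ (Fin p)} {C c m : ℝ}

lemma aemeasurable_residualNorm_cond (hlip : LipschitzWith lam f) (hf' : Continuous (deriv f))
    (hε : 0 < ε) (hx : ∀ j, Measurable (x j)) (i : Fin n) :
    AEMeasurable (fun ω => residualNorm f (fun j => x j ω) i) (P[|goodEvent x lam ε]) :=
  aemeasurable_comp_cond (F := fun a => residualNorm f a i) (measurable_pi_lambda _ hx)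
    (isClosed_goodData lam ε).measurableSet
    (continuousOn_residualNorm hlip hf' hε i).domRestrict.measurable

variable [IsProbabilityMeasure P]

lemma measureReal_goodEvent_inter_le_norm_crossForms (hlip : LipschitzWith lam f)
    (hf' : Continuous (deriv f)) (hlam : 0 < lam) (hε : 0 < ε) (hC : 0 ≤ C) (hc : 0 < c)
    (hx : ∀ j, Measurable (x j)) (hindep : iIndepFun x P) {i : Fin n}
    (hi : ConcentratedWith P (x i) C c) (hm : ‖∫ ω, x i ω ∂P‖ ≤ m) {t : ℝ} (ht : 0 < t) :
    P.real (goodEvent x lam ε ∩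
        {ω | √(n / lam) / ε * (linearMoment 4 C c m * (n : ℝ) ^ (1 / 4 : ℝ) + t)
          ≤ ‖crossForms f (fun j => x j ω) i (x i ω)‖})
      ≤ C * Real.exp (-(t / c) ^ 2) := by
  have hn : (0 : ℝ) < n := by exact_mod_cast i.pos
  set r := √(n / lam) / ε * (linearMoment 4 C c m * (n : ℝ) ^ (1 / 4 : ℝ) + t)
  set T : Set ((Fin n → EuclideanSpace ℝ (Fin p)) × EuclideanSpace ℝ (Fin p)) :=
    (goodData n p lam ε ×ˢ Set.univ) ∩ (fun q => ‖crossForms f q.1 i q.2‖) ⁻¹' Set.Ici r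
  have hT : MeasurableSet T :=
    ((continuousOn_norm_crossForms hlip hf' hε i).preimage_isClosed_of_isClosed
      ((isClosed_goodData lam ε).prod isClosed_univ) isClosed_Ici).measurableSet
  have hfrozen : ∀ a, P {ω | (a, x i ω) ∈ T} ≤ ENNReal.ofReal (C * Real.exp (-(t / c) ^ 2)) := by
    intro a
    by_cases ha : a ∈ goodData n p lam ε
    · rw [← ofReal_measureReal]
      refine ENNReal.ofReal_le_ofReal ((measureReal_mono fun ω hω => ?_).trans
        (hi.measureReal_norm_clm_piLp_le hC hc (hx i) hm ENNReal.ofNat_ne_top (by positivity)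
          (norm_crossForms_le hlip hlam hε ha i) ht))
      simpa only [ENNReal.toReal_ofNat, Fintype.card_fin] using! hω.2
    · simp [T, ha]
  refine ENNReal.toReal_le_of_le_ofReal (by positivity) ((measure_mono fun ω hω => ?_).trans
    (measure_le_of_indepFun (measurable_update_zero hx i) (hx i)
      (indepFun_update_zero hindep hx i) hT hfrozen))
  refine ⟨⟨update_zero_mem_goodData hω.1 i, trivial⟩, ?_⟩
  simpa only [Set.mem_preimage, Set.mem_Ici, crossForms_update] using! hω.2

lemma cond_real_residualOffset_add_lt_le (hf : Differentiable ℝ f) (hlip : LipschitzWith lam f)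
    (hL : LipschitzWith L (deriv f)) (hlam : 0 < lam) (hε : 0 < ε) (hB : ∀ u, |f u| ≤ B)
    (hC : 0 ≤ C) (hc : 0 < c) (hx : ∀ j, Measurable (x j)) (hindep : iIndepFun x P)
    (hA : ε ≤ P.real (goodEvent x lam ε)) {i : Fin n} (hi : ConcentratedWith P (x i) C c)
    (hm : ‖∫ ω, x i ω ∂P‖ ≤ m) {t : ℝ} (ht : 0 < t) :
    (P[|goodEvent x lam ε]).real {ω | residualOffset lam ε L B (linearMoment 4 C c m)
        + residualSlope lam ε L B * t < n * residualNorm f (fun j => x j ω) i}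
      ≤ ε⁻¹ * C * Real.exp (-(t / c) ^ 2) := by
  rw [mul_assoc]
  refine (cond_real_le (measurableSet_goodEvent hx lam ε) hε hA).trans ?_
  gcongr ε⁻¹ * ?_
  refine le_trans (measureReal_mono ?_) (measureReal_goodEvent_inter_le_norm_crossForms hlip
    hL.continuous hlam hε hC hc hx hindep hi hm ht)
  rintro ω ⟨hωA, hω⟩
  refine ⟨hωA, ?_⟩
  rw [Set.mem_ofPred_eq] at hω ⊢
  contrapose! hω
  exact natCast_mul_residualNorm_le_affine hf hlip hL hlam hε hB hωA ht.le hω.le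

lemma cond_real_le_natCast_mul_residualNorm_le (hf : Differentiable ℝ f)
    (hlip : LipschitzWith lam f) (hL : LipschitzWith L (deriv f)) (hlam : 0 < lam) (hε : 0 < ε)
    (hB : ∀ u, |f u| ≤ B) (hB₀ : 0 < B) (hC : 0 ≤ C) (hc : 0 < c) (hx : ∀ j, Measurable (x j))
    (hindep : iIndepFun x P) (hA : ε ≤ P.real (goodEvent x lam ε)) {i : Fin n}
    (hi : ConcentratedWith P (x i) C c) (hm : ‖∫ ω, x i ω ∂P‖ ≤ m) {s : ℝ} (hs : 0 < s) :
    (P[|goodEvent x lam ε]).real {ω | s ≤ n * residualNorm f (fun j => x j ω) i}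
      ≤ (ε⁻¹ * C + Real.exp 1) * Real.exp (-(s / (4 * residualSlope lam ε L B * c
        + 2 * residualOffset lam ε L B (linearMoment 4 C c m))) ^ 2) := by
  have := cond_isProbabilityMeasure (measure_ne_zero_of_le_measureReal hε hA)
  exact measureReal_le_of_affine_tail (by positivity) hc (residualOffset_nonneg hε.le hB₀.le)
    (residualSlope_pos hε hB₀) (fun t ht => cond_real_residualOffset_add_lt_le hf hlip hL hlam hε
      hB hC hc hx hindep hA hi hm ht) hs

end Residual

section Families

variable {S : Type*} {Ω : S → Type*} [∀ s, MeasurableSpace (Ω s)] {P : ∀ s, Measure (Ω s)}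

lemma linearlyConcentratedOn_zero_of_tail {A : ∀ s, Set (Ω s)} {Z : ∀ s, Ω s → ℝ} {σ θ : S → ℝ}
    {C D κ d : ℝ} (hmeas : ∀ s, MeasurableSet (A s) ∧ P s (A s) ≠ 0 ∧
      AEStronglyMeasurable (Z s) ((P s)[|A s]))
    (hC : 0 < C) (hD : 0 < D) (hκ : 0 < κ) (hd : 0 < d) (hσ : ∀ s, 0 < σ s) (hθ : ∀ s, 0 ≤ θ s)
    (hcompl : ∀ s, (P s).real (A s)ᶜ ≤ C * Real.exp (-(κ * θ s)))
    (htail : ∀ s t, 0 < t →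
      ((P s)[|A s]).real {ω | t ≤ |Z s ω| / σ s} ≤ D * Real.exp (-(t / d) ^ 2)) :
    LinearlyConcentratedOn P A Z (fun _ => 0) 2 σ θ := by
  refine ⟨hmeas, C + D, by positivity, κ⁻¹ + d, by positivity, fun s =>
    ⟨(hcompl s).trans ?_, fun φ hφ t ht => ?_⟩⟩
  · have hrate : θ s / (κ⁻¹ + d) ≤ κ * θ s := by
      rw [div_le_iff₀ (by positivity), mul_add, mul_right_comm, mul_inv_cancel₀ hκ.ne', one_mul]
      have := hθ s
      exact le_add_of_nonneg_right (by positivity)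
    gcongr
    exact le_add_of_nonneg_right hD.le
  · have hsub : {ω | t ≤ |φ (Z s ω) - φ 0|} ⊆ {ω | t / σ s ≤ |Z s ω| / σ s} := fun ω hω => by
      rw [Set.mem_ofPred_eq, map_zero, sub_zero] at hω
      refine div_le_div_of_nonneg_right (hω.trans ?_) (hσ s).le
      simpa using φ.le_of_opNorm_le hφ (Z s ω)
    have hrate : t / ((κ⁻¹ + d) * σ s) ≤ t / σ s / d := by
      rw [mul_comm, ← div_div]
      have := hσ s
      gcongr
      exact le_add_of_nonneg_left (by positivity)
    calc ((P s)[|A s]).real {ω | t ≤ |φ (Z s ω) - φ 0|} ≤ D * Real.exp (-(t / σ s / d) ^ 2) :=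
          (measureReal_mono hsub).trans (htail s _ (div_pos ht (hσ s)))
      _ ≤ (C + D) * Real.exp (-(t / ((κ⁻¹ + d) * σ s)) ^ (2 : ℝ)) := by
          rw [Real.rpow_two]
          have := hσ s
          gcongr
          exact le_add_of_nonneg_left hC.le

variable [∀ s, IsProbabilityMeasure (P s)] {n p : S → ℕ}
  {x : ∀ s, Fin (n s) → Ω s → EuclideanSpace ℝ (Fin (p s))} {f : ℝ → ℝ} {lam L : ℝ≥0}
  {ε B C c m : ℝ}

lemma exists_forall_lintegral_supBridge_cond_le (hlip : LipschitzWith lam f) (hlam : 0 < lam)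
    (hε : 0 < ε) (hC : 0 ≤ C) (hc : 0 < c) (hx : ∀ s j, Measurable (x s j))
    (hindep : ∀ s, iIndepFun (x s) (P s)) (hA : ∀ s, ε ≤ (P s).real (goodEvent (x s) lam ε))
    (hX : ∀ s, ConcentratedWith (P s) (fun ω => WithLp.toLp 2 fun j => x s j ω) C c)
    (hm : ∀ s j, ‖∫ ω, x s j ω ∂(P s)‖ ≤ m) :
    ∃ K : ℝ≥0, ∀ s i,
      ∫⁻ ω, supBridge f (fun j => x s j ω) i ∂((P s)[|goodEvent (x s) lam ε]) ≤ K := by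
  lift ENNReal.ofReal ε⁻¹ * (ENNReal.ofReal (1 + ε⁻¹)
      * ENNReal.ofReal (ε⁻¹ * (|f 0| * √(lam : ℝ)⁻¹) * linearMoment 1 C c m)
    + ENNReal.ofReal (|f 0| / (lam * ε))) to ℝ≥0 using by finiteness with K hK
  refine ⟨K, fun s i => hK ▸ ?_⟩
  exact lintegral_supBridge_cond_le hlip hlam hε hC hc (hx s) (hindep s) (hA s)
    ((hX s).column i) (hm s i)

lemma linearlyConcentratedOn_residualNorm (hf : Differentiable ℝ f) (hlip : LipschitzWith lam f)
    (hL : LipschitzWith L (deriv f)) (hlam : 0 < lam) (hε : 0 < ε) (hB : ∀ u, |f u| ≤ B)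
    (hB₀ : 0 < B) (hC : 0 < C) (hc : 0 < c) (hx : ∀ s j, Measurable (x s j))
    (hindep : ∀ s, iIndepFun (x s) (P s)) (hA : ∀ s, ε ≤ (P s).real (goodEvent (x s) lam ε))
    (hX : ∀ s, ConcentratedWith (P s) (fun ω => WithLp.toLp 2 fun j => x s j ω) C c)
    (hm : ∀ s j, ‖∫ ω, x s j ω ∂(P s)‖ ≤ m)
    (hcontr : ∀ s, 2 * ε ≤ 1 - lam / n s * ∫ ω, gramNorm (fun j => x s j ω) ∂(P s))
    (i : ∀ s, Fin (n s)) :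
    LinearlyConcentratedOn P (fun s => goodEvent (x s) lam ε)
      (fun s ω => residualNorm f (fun j => x s j ω) (i s)) (fun _ => 0) 2
      (fun s => 1 / (n s : ℝ)) fun s => n s := by
  have hlam' : (0 : ℝ) < lam := hlam
  have hn : ∀ s, (0 : ℝ) < n s := fun s => by exact_mod_cast (i s).pos
  have hθ : 0 ≤ residualOffset lam ε L B (linearMoment 4 C c m) :=
    residualOffset_nonneg hε.le hB₀.le
  have hv : 0 < residualSlope lam ε L B := residualSlope_pos hε hB₀
  refine linearlyConcentratedOn_zero_of_tail (fun s =>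
      ⟨measurableSet_goodEvent (hx s) lam ε,
        measure_ne_zero_of_le_measureReal hε (hA s),
        (aemeasurable_residualNorm_cond hlip hL.continuous hε (hx s) (i s)).aestronglyMeasurable⟩)
    hC (D := ε⁻¹ * C + Real.exp 1) (κ := (ε / 2) ^ 2 / (lam * c ^ 2))
    (d := 4 * residualSlope lam ε L B * c
      + 2 * residualOffset lam ε L B (linearMoment 4 C c m))
    (by positivity) (by positivity) (by positivity) (fun s => one_div_pos.2 (hn s))
    (fun s => (hn s).le)
    (fun s => measureReal_goodEvent_compl_le hlam' hε hC.le hc (hX s) (hcontr s))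
    fun s t ht => ?_
  have hscale : ∀ ω, |residualNorm f (fun j => x s j ω) (i s)| / (1 / (n s : ℝ))
      = n s * residualNorm f (fun j => x s j ω) (i s) := fun ω => by
    rw [div_div_eq_mul_div, div_one, mul_comm, residualNorm, abs_norm]
  simp_rw [hscale]
  exact cond_real_le_natCast_mul_residualNorm_le hf hlip hL hlam hε hB hB₀ hC.le hc (hx s)
    (hindep s) (hA s) ((hX s).column (i s)) (hm s (i s)) ht

end Families

end RobustRegression

end

open RobustRegression in
theorem mainTheorem12_general
    {S : Type*} {Ω : S → Type*} [∀ s, MeasurableSpace (Ω s)]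
    (P : ∀ s, Measure (Ω s)) [∀ s, IsProbabilityMeasure (P s)]
    (n p : S → ℕ)
    (x : ∀ s, Fin (n s) → Ω s → EuclideanSpace ℝ (Fin (p s)))
    (hmeas : ∀ s j, Measurable (x s j))
    (hconc : LipschitzConcentrated
      (E := fun s => PiLp 2 (fun _ : Fin (n s) => EuclideanSpace ℝ (Fin (p s))))
      P (fun s ω => WithLp.toLp 2 (fun j => x s j ω)) 2 (fun _ => 1))
    (hindep : ∀ s, iIndepFun (x s) (P s))
    (hmean : ∃ m : ℝ, ∀ s j, ‖∫ ω, x s j ω ∂(P s)‖ ≤ m)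
    (f : ℝ → ℝ) (hf : Differentiable ℝ f) (hf' : ∃ L : ℝ≥0, LipschitzWith L (deriv f))
    (lam : ℝ) (hlam : 0 < lam) (hflam : ∀ u, |deriv f u| ≤ lam)
    (ε : ℝ) (hε : 0 < ε)
    (hcontr : ∀ s, 2 * ε ≤
      1 - lam / n s * ∫ ω, gramNorm (fun j => x s j ω) ∂(P s)) :
    (∀ s, ∀ ω ∈ goodEvent (x s) lam ε,
      (∃! y, y = regressionMap f (fun j => x s j ω) y) ∧
      ∀ i, (∃! y, y = leaveOneOutMap f (fun j => x s j ω) i y) ∧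
        (∀ t ∈ Set.Icc (0 : ℝ) 1,
          ∃! y, y = bridgeMap f (fun j => x s j ω) i t y) ∧
        IsUnit (preResolvent f (fun j => x s j ω) i)) ∧
    (∃ C > 0, ∃ c > 0, ∀ s, P s (goodEvent (x s) lam ε) ≠ 0 ∧
      (P s).real (goodEvent (x s) lam ε)ᶜ ≤ C * Real.exp (-(c * n s))) ∧
    (∃ K : ℝ≥0, ∀ s i,
      AEMeasurable (fun ω => supBridge f (fun j => x s j ω) i)
        ((P s)[|goodEvent (x s) lam ε]) ∧
      ∫⁻ ω, supBridge f (fun j => x s j ω) i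
        ∂((P s)[|goodEvent (x s) lam ε]) ≤ K) ∧
    ((∃ B : ℝ, ∀ u, |f u| ≤ B) →
      LinearlyConcentratedOn (S := Σ s, Fin (n s)) (Ω := fun k => Ω k.1)
        (E := fun _ => ℝ)
        (fun k => P k.1)
        (fun k => goodEvent (x k.1) lam ε)
        (fun k ω => residualNorm f (fun j => x k.1 j ω) k.2)
        (fun _ => 0) 2 (fun k => 1 / (n k.1 : ℝ)) (fun k => (n k.1 : ℝ))) := by
  lift lam to ℝ≥0 using hlam.le
  rw [NNReal.coe_pos] at hlam
  obtain ⟨L, hL⟩ := hf'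
  obtain ⟨m, hm⟩ := hmean
  obtain ⟨C, hC, c, hc, hX⟩ := hconc.exists_concentratedWith
  have hlip : LipschitzWith lam f := lipschitzWith_of_nnnorm_deriv_le hf hflam
  have hA : ∀ s, ε ≤ (P s).real (goodEvent (x s) lam ε) := fun s =>
    le_measureReal_goodEvent (hmeas s) lam.coe_nonneg hε
      (integrable_gramNorm hC.le hc (hX s)) (hcontr s)
  obtain ⟨K, hK⟩ :=
    exists_forall_lintegral_supBridge_cond_le hlip hlam hε hC.le hc hmeas hindep hA hX hm
  refine ⟨fun s ω hω => ⟨existsUnique_regressionMap hlip hε hω, fun i =>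
      ⟨existsUnique_leaveOneOutMap hlip hε hω i,
        fun t ht => existsUnique_bridgeMap hlip hε hω i ht, isUnit_preResolvent hlip hε hω i⟩⟩,
    ⟨C, hC, (ε / 2) ^ 2 / (lam * c ^ 2), by positivity, fun s =>
      ⟨measure_ne_zero_of_le_measureReal hε (hA s),
        measureReal_goodEvent_compl_le hlam hε hC.le hc (hX s) (hcontr s)⟩⟩,
    ⟨K, fun s i => ⟨aemeasurable_supBridge_cond hlip hε (hmeas s) i, hK s i⟩⟩, ?_⟩
  rintro ⟨B, hB⟩
  exact linearlyConcentratedOn_residualNorm (P := fun k : Σ s, Fin (n s) => P k.1)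
    (x := fun k => x k.1) hf hlip hL hlam hε
    (fun u => (hB u).trans ((le_abs_self B).trans (le_add_of_nonneg_right zero_le_one)))
    (by positivity) hC hc (fun k => hmeas k.1) (fun k => hindep k.1) (fun k => hA k.1)
    (fun k => hX k.1) (fun k => hm k.1) (fun k => hcontr k.1) Sigma.snd

theorem mainTheorem12
    {S : Type*} {Ω : S → Type*} [∀ s, MeasurableSpace (Ω s)]
    (P : ∀ s, Measure (Ω s)) [∀ s, IsProbabilityMeasure (P s)]
    (n p : S → ℕ)
    (x : ∀ s, Fin (n s) → Ω s → EuclideanSpace ℝ (Fin (p s)))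
    (hmeas : ∀ s j, Measurable (x s j))
    -- `X ∝ 𝓔₂` for the Frobenius norm
    (hconc : RobustRegression.LipschitzConcentrated
      (E := fun s => PiLp 2 (fun _ : Fin (n s) => EuclideanSpace ℝ (Fin (p s))))
      P (fun s ω => WithLp.toLp 2 (fun j => x s j ω)) 2 (fun _ => 1))
    -- independent columns
    (hindep : ∀ s, iIndepFun (x s) (P s))
    -- `n` and `p` are of the same order
    (hnp : ∃ a > 0, ∃ b > 0, ∀ s, a * (p s : ℝ) ≤ n s ∧ (n s : ℝ) ≤ b * p s)
    -- bounded means, energies bounded from below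
    (hmean : ∃ m : ℝ, ∀ s j, ‖∫ ω, x s j ω ∂(P s)‖ ≤ m)
    (henergy : ∃ κ > 0, ∀ s j,
      κ ≤ 1 / (n s : ℝ) * (RobustRegression.secondMoment (P s) (x s j)).trace)
    (f : ℝ → ℝ) (hf : Differentiable ℝ f) (hf' : Differentiable ℝ (deriv f))
    (lam : ℝ) (hlam : 0 < lam) (hflam : ∀ u, |deriv f u| ≤ lam)
    (hf'' : ∃ L : ℝ, ∀ u, |deriv (deriv f) u| ≤ L)
    (ε : ℝ) (hε : 0 < ε)
    (hcontr : ∀ s, 2 * ε ≤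
      1 - lam / n s * ∫ ω, RobustRegression.gramNorm (fun j => x s j ω) ∂(P s)) :
    -- on the event `𝓐_Y`, all the objects are well defined
    (∀ s, ∀ ω ∈ RobustRegression.goodEvent (x s) lam ε,
      (∃! y, y = RobustRegression.regressionMap f (fun j => x s j ω) y) ∧
      ∀ i, (∃! y, y = RobustRegression.leaveOneOutMap f (fun j => x s j ω) i y) ∧
        (∀ t ∈ Set.Icc (0 : ℝ) 1,
          ∃! y, y = RobustRegression.bridgeMap f (fun j => x s j ω) i t y) ∧
        IsUnit (RobustRegression.preResolvent f (fun j => x s j ω) i)) ∧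
    -- `𝓐_Y` has overwhelming probability
    (∃ C > 0, ∃ c > 0, ∀ s, P s (RobustRegression.goodEvent (x s) lam ε) ≠ 0 ∧
      (P s).real (RobustRegression.goodEvent (x s) lam ε)ᶜ ≤ C * Real.exp (-(c * n s))) ∧
    -- `M_i ≤ O(1)`
    (∃ K : NNReal, ∀ s i,
      AEMeasurable (fun ω => RobustRegression.supBridge f (fun j => x s j ω) i)
        ((P s)[|RobustRegression.goodEvent (x s) lam ε]) ∧
      ∫⁻ ω, RobustRegression.supBridge f (fun j => x s j ω) i
        ∂((P s)[|RobustRegression.goodEvent (x s) lam ε]) ≤ K) ∧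
    -- `‖Y - Y₋ᵢ - (1/n) f(xᵢᵀ Y) Q₋ᵢ xᵢ‖ ∈ 0 ± 𝓔₂(1/n) | e^{-n}`, uniformly in `i`
    ((∃ B : ℝ, ∀ u, |f u| ≤ B) →
      RobustRegression.LinearlyConcentratedOn (S := Σ s, Fin (n s)) (Ω := fun k => Ω k.1)
        (E := fun _ => ℝ)
        (fun k => P k.1)
        (fun k => RobustRegression.goodEvent (x k.1) lam ε)
        (fun k ω => RobustRegression.residualNorm f (fun j => x k.1 j ω) k.2)
        (fun _ => 0) 2 (fun k => 1 / (n k.1 : ℝ)) (fun k => (n k.1 : ℝ))) := by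
  obtain ⟨L, hL⟩ := hf''
  exact mainTheorem12_general P n p x hmeas hconc hindep hmean f hf
    ⟨L.toNNReal, lipschitzWith_of_nnnorm_deriv_le hf' fun u => NNReal.coe_le_coe.1 <|
      (hL u).trans (Real.le_coe_toNNReal L)⟩ lam hlam hflam ε hε hcontr
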